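/- Let $u$ be a weight on $\mathbb R$ (a locally integrable function that is positive almost everywhere) and let $w$ be a weight on $(0,\infty)$ (a measurable function that is positive almost everywhere) such that $W(t)=\int_0^t w(s)\,ds<\infty$ for every $t>0$ and $w\in\Delta_2$, i.e. there is a constant $c$ with $W(2r)\le c\,W(r)$ for all $r>0$. Write $u(E)=\int_E u(x)\,dx$. For a measurable function $f$ on $\mathbb R$ put $$f^*_u(t)=\inf\{s>0:\ u(\{x:|f(x)|>s\})\le t\},$$ $$\|f\|_{\Lambda^p_u(w)}=\Big(\int_0^\infty (f^*_u(t))^p\,w(t)\,dt\Big)^{1/p},\qquad \|f\|_{\Lambda^{p,\infty}_u(w)}=\sup_{t>0} f^*_u(t)\,W(t)^{1/p},$$ and let $\Lambda^p_u(w)$ and $\Lambda^{p,\infty}_u(w)$ be the classes of measurable $f$ for which the respective quantity is finite. Let $Mf(x)=\sup_{I\ni x}\frac1{|I|}\int_I|f(y)|\,dy$ be the Hardy--Littlewood maximal function, the supremum being taken over all bounded nondegenerate intervals $I$ containing $x$; $M:X\to Y$ is called bounded if there is a constant $C$ with $\|Mf\|_Y\le C\|f\|_X$ for all $f\in X$.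 For $t>1$ let $$\overline W_u(t)=\sup\left\{\frac{W\big(u(\bigcup_j I_j)\big)}{W\big(u(\bigcup_j S_j)\big)}:\ S_j\subseteq I_j\ \text{and}\ |I_j|<t\,|S_j|\ \text{for every } j\right\},$$ where the supremum is over all nonempty finite families of pairwise disjoint intervals $I_j$ and measurable sets $S_j$. If $p>1$, then $$M:\Lambda^p_u(w)\to\Lambda^{p,\infty}_u(w)\ \text{ is bounded}$$ if and only if there are a real number $q<p$ and a constant $C$ such that $\overline W_u(t)\le C\,t^q$ for every $t>1$. Moreover, $M:\Lambda^p_u(w)\to\Lambda^{p,\infty}_u(w)$ is bounded if and only if $M:\Lambda^p_u(w)\to\Lambda^p_u(w)$ is bounded. -/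

import Mathlib

open MeasureTheory Set
open scoped ENNReal NNReal

namespace WeightedLorentz

/-- The measure `u(E) = ∫_E u(x) dx` on the real line associated with the weight `u`. -/
noncomputable def weightMeasure (u : ℝ → ℝ) : Measure ℝ :=
  volume.withDensity fun x => ENNReal.ofReal (u x)

/-- The primitive `W(t) = ∫_0^t w(s) ds` of a weight `w` on `(0, ∞)`, for `t ∈ [0, ∞]`. -/
noncomputable def primitive (w : ℝ → ℝ) (t : ℝ≥0∞) : ℝ≥0∞ :=
  ∫⁻ s in {s : ℝ | 0 < s ∧ ENNReal.ofReal s < t}, ENNReal.ofReal (w s)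

/-- The condition `w ∈ Δ₂`: `W(2r) ≲ W(r)` for `r > 0`. -/
def DeltaTwo (w : ℝ → ℝ) : Prop :=
  ∃ C : ℝ≥0, ∀ r : ℝ, 0 < r →
    primitive w (ENNReal.ofReal (2 * r)) ≤ C * primitive w (ENNReal.ofReal r)

/-- The decreasing rearrangement `g*_u(t) = inf {s > 0 : u({g > s}) ≤ t}` of a function `g` with
values in `[0, ∞]` (for a real function `f` it is applied to `g = |f|`). -/
noncomputable def rearrangement (u : ℝ → ℝ) (g : ℝ → ℝ≥0∞) (t : ℝ) : ℝ≥0∞ :=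
  sInf {s : ℝ≥0∞ | 0 < s ∧ weightMeasure u {x | s < g x} ≤ ENNReal.ofReal t}

/-- The functional `(∫_0^∞ (g*_u(t))^p w(t) dt)^{1/p}` defining `Λ^p_u(w)`. -/
noncomputable def lorentzNorm (p : ℝ) (u w : ℝ → ℝ) (g : ℝ → ℝ≥0∞) : ℝ≥0∞ :=
  (∫⁻ t in Ioi (0 : ℝ), rearrangement u g t ^ p * ENNReal.ofReal (w t)) ^ (1 / p)

/-- The functional `sup_{t > 0} g*_u(t) W(t)^{1/p}` defining `Λ^{p,∞}_u(w)`. -/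
noncomputable def weakLorentzNorm (p : ℝ) (u w : ℝ → ℝ) (g : ℝ → ℝ≥0∞) : ℝ≥0∞ :=
  ⨆ (t : ℝ) (_ : 0 < t), rearrangement u g t * primitive w (ENNReal.ofReal t) ^ (1 / p)

/-- Membership of a (Lebesgue measurable) function in `Λ^p_u(w)`. -/
def MemLorentz (p : ℝ) (u w : ℝ → ℝ) (f : ℝ → ℝ) : Prop :=
  AEMeasurable f volume ∧ lorentzNorm p u w (fun x => ‖f x‖ₑ) < ∞

/-- The Hardy–Littlewood maximal function `Mf(x) = sup_{I ∋ x} |I|⁻¹ ∫_I |f|`, with values in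
`[0, ∞]`; the supremum is over the nondegenerate compact intervals `I` containing `x`, which gives
the same value as the supremum over all bounded nondegenerate intervals containing `x`. -/
noncomputable def maximalFunction (f : ℝ → ℝ) (x : ℝ) : ℝ≥0∞ :=
  ⨆ (a : ℝ) (b : ℝ) (_ : a < b) (_ : x ∈ Icc a b), (∫⁻ y in Icc a b, ‖f y‖ₑ) / volume (Icc a b)

/-- `M : Λ^p_u(w) → Λ^p_u(w)` is bounded. -/
def StrongBounded (p : ℝ) (u w : ℝ → ℝ) : Prop :=
  ∃ C : ℝ≥0, ∀ f : ℝ → ℝ, MemLorentz p u w f →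
    lorentzNorm p u w (maximalFunction f) ≤ C * lorentzNorm p u w (fun x => ‖f x‖ₑ)

/-- `M : Λ^p_u(w) → Λ^{p,∞}_u(w)` is bounded. -/
def WeakBounded (p : ℝ) (u w : ℝ → ℝ) : Prop :=
  ∃ C : ℝ≥0, ∀ f : ℝ → ℝ, MemLorentz p u w f →
    weakLorentzNorm p u w (maximalFunction f) ≤ C * lorentzNorm p u w (fun x => ‖f x‖ₑ)

/-- `I₁, …, I_J` are pairwise disjoint intervals, and `S_j ⊆ I_j` are Lebesgue measurable sets with
`|I_j| < t |S_j|` for every `j` (so that `|S_j| > 0` and `I_j` has finite positive length). -/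
structure Admissible (t : ℝ) {J : ℕ} (I S : Fin J → Set ℝ) : Prop where
  interval : ∀ j, (I j).OrdConnected
  disjoint : Pairwise fun i j => Disjoint (I i) (I j)
  measurable : ∀ j, NullMeasurableSet (S j) volume
  subset : ∀ j, S j ⊆ I j
  length_lt : ∀ j, volume (I j) < ENNReal.ofReal t * volume (S j)

/-- The function `W̄_u(t) = sup W(u(⋃ I_j)) / W(u(⋃ S_j))`, the supremum being over all finite
admissible families. The empty family contributes `0 / 0 = 0` and does not affect the supremum. -/
noncomputable def Wbar (u w : ℝ → ℝ) (t : ℝ) : ℝ≥0∞ :=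
  ⨆ (J : ℕ) (I : Fin J → Set ℝ) (S : Fin J → Set ℝ) (_ : Admissible t I S),
    primitive w (weightMeasure u (⋃ j, I j)) / primitive w (weightMeasure u (⋃ j, S j))

end WeightedLorentz

/-! Everything is reduced to the sets `denseSet E l`, which for measurable E are the superlevel sets
of the maximal function of the indicator of E. A bound `Wbar(t) ≲ t^q` amounts to the restricted
weak-type estimate W(u(denseSet E l)) ≲ l^(-q) W(u(E)).

Weak boundedness tested on indicators gives this estimate with exponent p only. The gain comes from
a better test function, `densityLadder E n`: the sum over k = 1, ..., n of the indicators of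
`denseSet E (2^-k)` with weights 2^(n-k)/n. By a reverse weak-type estimate
(`volume_le_five_mul_denseSet`), if E has density l * m in an interval, then `denseSet E l` has
density comparable to m nearby; so every rung contributes equally and the maximal function of the
ladder exceeds 1/16 on `denseSet E (2^-n)`. The p-th power of its norm is at most a constant times n
(2^n / n)^p W(u(E)). Since p > 1, the extra factor n^(1-p) makes the constant at a single scale y =
2^m smaller than y^p, and iterating that scale through `denseSet_mul_subset` produces an exponent q
< p.

Conversely, the Besicovitch covering theorem turns `Wbar` into a restricted weak-type estimate
without any doubling of u. Splitting f at the levels B^j s covers {Mf > 2Bs} by density sets of {|f|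
> B^j s}. W is only quasi-subadditive, with a loss D^j in the j-th term, but after integration in s
that term is of size (D 2^q B^(q-p))^j, which is summable for B large. Strong implies weak by
Chebyshev's inequality. -/

namespace WeightedLorentz

open Filter Topology

/-! ### The primitive W: left continuity, finiteness, positivity, quasi-subadditivity. -/

theorem primitive_mono (w : ℝ → ℝ) : Monotone (primitive w) := fun _ _ h =>
  lintegral_mono_set fun _ hs => ⟨hs.1, hs.2.trans_le h⟩

theorem primitive_zero (w : ℝ → ℝ) : primitive w 0 = 0 := by
  simp [primitive]

/-- Left continuity of W, due to the strict inequality in its domain of integration. It is what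
allows W(u(·)) to pass to increasing unions. -/
theorem primitive_iSup (w : ℝ → ℝ) {a : ℕ → ℝ≥0∞} (ha : Monotone a) :
    primitive w (⨆ n, a n) = ⨆ n, primitive w (a n) := by
  unfold primitive
  rw [← setLIntegral_iUnion_of_directed]
  · congr 2
    ext s
    simp [lt_iSup_iff]
  · exact Monotone.directed_le fun m n h s hs => ⟨hs.1, hs.2.trans_le (ha h)⟩

/-- The measure `w(t) dt` on the half-line. -/
noncomputable def halfLineMeasure (w : ℝ → ℝ) : Measure ℝ :=
  (volume.restrict (Ioi 0)).withDensity fun t => ENNReal.ofReal (w t)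

theorem halfLineMeasure_ofReal_lt (w : ℝ → ℝ) (a : ℝ≥0∞) :
    halfLineMeasure w {t | ENNReal.ofReal t < a} = primitive w a := by
  have hm : MeasurableSet {t : ℝ | ENNReal.ofReal t < a} :=
    measurableSet_lt ENNReal.measurable_ofReal measurable_const
  rw [halfLineMeasure, withDensity_apply _ hm, Measure.restrict_restrict hm, primitive]
  congr 2
  ext s
  simp [and_comm]

theorem aemeasurable_of_integrableOn_Ioc {w : ℝ → ℝ}
    (hw : ∀ r : ℝ, 0 < r → IntegrableOn w (Ioc 0 r) volume) :
    AEMeasurable w (volume.restrict (Ioi 0)) := by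
  have h : Ioi (0 : ℝ) = ⋃ n : ℕ, Ioc 0 ((n : ℝ) + 1) := by
    ext x
    simp only [mem_Ioi, mem_iUnion, mem_Ioc]
    refine ⟨fun hx => ?_, fun ⟨n, hn⟩ => hn.1⟩
    obtain ⟨n, hn⟩ := exists_nat_ge x
    exact ⟨n, hx, by linarith⟩
  rw [h, aemeasurable_iUnion_iff]
  exact fun n => (hw _ (by positivity)).1.aemeasurable

theorem primitive_ne_top {w : ℝ → ℝ} (hw : ∀ r : ℝ, 0 < r → IntegrableOn w (Ioc 0 r) volume)
    {a : ℝ≥0∞} (ha : a ≠ ∞) : primitive w a ≠ ∞ := by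
  have h1 : primitive w a ≤ ∫⁻ s in Ioc 0 (a.toReal + 1), ENNReal.ofReal (w s) := by
    refine lintegral_mono_set fun s hs => ⟨hs.1, ?_⟩
    have := (ENNReal.ofReal_lt_iff_lt_toReal hs.1.le ha).1 hs.2
    linarith
  have h2 := (hw (a.toReal + 1) (by positivity)).lintegral_lt_top
  exact (h1.trans_lt h2).ne

theorem primitive_ne_zero {w : ℝ → ℝ} (hw : ∀ r : ℝ, 0 < r → IntegrableOn w (Ioc 0 r) volume)
    (hpos : ∀ᵐ s : ℝ, 0 < s → 0 < w s) {a : ℝ≥0∞} (ha : a ≠ 0) : primitive w a ≠ 0 := by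
  obtain ⟨r, hr0, hra⟩ : ∃ r : ℝ, 0 < r ∧ ENNReal.ofReal r ≤ a := by
    obtain ⟨b, hb0, hb⟩ := exists_between (pos_iff_ne_zero.2 ha)
    exact ⟨b.toReal, ENNReal.toReal_pos hb0.ne' hb.ne_top, by
      rw [ENNReal.ofReal_toReal hb.ne_top]; exact hb.le⟩
  have h1 : ∫⁻ s in Ioo 0 r, ENNReal.ofReal (w s) ≤ primitive w a := by
    refine lintegral_mono_set fun s hs => ⟨hs.1, lt_of_lt_of_le ?_ hra⟩
    exact (ENNReal.ofReal_lt_ofReal_iff hr0).2 hs.2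
  have hm : AEMeasurable (fun s => ENNReal.ofReal (w s)) (volume.restrict (Ioo 0 r)) :=
    ((hw r hr0).1.aemeasurable.mono_measure
      (Measure.restrict_mono Ioo_subset_Ioc_self le_rfl)).ennreal_ofReal
  intro h0
  have h2 : ∫⁻ s in Ioo 0 r, ENNReal.ofReal (w s) = 0 := le_antisymm (h0 ▸ h1) bot_le
  rw [lintegral_eq_zero_iff' hm] at h2
  have h3 : ∀ᵐ s ∂volume.restrict (Ioo 0 r), False := by
    filter_upwards [h2, ae_restrict_of_ae hpos, ae_restrict_mem measurableSet_Ioo] with s hs hp hm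
    have := hp hm.1
    simp only [Pi.zero_apply, ENNReal.ofReal_eq_zero] at hs
    linarith
  simp only [eventually_false_iff_eq_bot, ae_eq_bot, Measure.restrict_eq_zero, Real.volume_Ioo,
    ENNReal.ofReal_eq_zero] at h3
  linarith

/-- The doubling condition extends to all of `[0, ∞]`. -/
theorem DeltaTwo.exists_doubling {w : ℝ → ℝ} (h : DeltaTwo w) :
    ∃ D : ℝ≥0, ∀ a : ℝ≥0∞, primitive w (2 * a) ≤ D * primitive w a := by
  obtain ⟨C, hC⟩ := h
  -- The maximum with 1 serves a = ∞, where 2a = a.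
  refine ⟨max 1 C, fun a => ?_⟩
  rcases eq_or_ne a 0 with rfl | h0
  · simp [primitive_zero]
  rcases eq_or_ne a ∞ with rfl | h1
  · rw [ENNReal.mul_top (by norm_num)]
    exact le_mul_of_one_le_left' (by exact_mod_cast le_max_left 1 C)
  · have := hC a.toReal (ENNReal.toReal_pos h0 h1)
    rw [ENNReal.ofReal_mul (by norm_num), ENNReal.ofReal_toReal h1] at this
    simp only [ENNReal.ofReal_ofNat] at this
    refine this.trans ?_
    gcongr
    exact le_max_right _ _

theorem primitive_two_pow_mul_le {w : ℝ → ℝ} {D : ℝ≥0}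
    (hD : ∀ a : ℝ≥0∞, primitive w (2 * a) ≤ D * primitive w a) (k : ℕ) (a : ℝ≥0∞) :
    primitive w (2 ^ k * a) ≤ D ^ k * primitive w a := by
  induction k with
  | zero => simp
  | succ k ih =>
    rw [pow_succ', pow_succ', mul_assoc, mul_assoc]
    exact (hD _).trans (by gcongr)

/-- Countable quasi-subadditivity of `W`. -/
theorem primitive_tsum_le {w : ℝ → ℝ} {D : ℝ≥0}
    (hD : ∀ a : ℝ≥0∞, primitive w (2 * a) ≤ D * primitive w a) (a : ℕ → ℝ≥0∞) :
    primitive w (∑' j, a j) ≤ D * ∑' j, D ^ j * primitive w (a j) := by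
  -- The sum of 2^(-j) b_j is at most twice the supremum of b, so a sum is traded for a supremum;
  -- undoing the factor 2^j inside W costs D^j.
  set b : ℕ → ℝ≥0∞ := fun j => 2 ^ j * a j with hb
  have h1 : ∑' j, a j ≤ 2 * ⨆ j, b j := by
    calc ∑' j, a j = ∑' j, (2⁻¹ : ℝ≥0∞) ^ j * b j := by
          congr 1; ext j
          rw [hb, ← mul_assoc, ← mul_pow, ENNReal.inv_mul_cancel (by norm_num) (by norm_num),
            one_pow, one_mul]
      _ ≤ ∑' j, (2⁻¹ : ℝ≥0∞) ^ j * ⨆ j, b j := by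
          gcongr with j
          exact le_iSup b j
      _ = 2 * ⨆ j, b j := by
          rw [ENNReal.tsum_mul_right, ENNReal.tsum_geometric, ENNReal.one_sub_inv_two, inv_inv]
  refine (primitive_mono w h1).trans ((hD _).trans ?_)
  gcongr
  have h2 : ⨆ j, b j = ⨆ j, partialSups b j := (iSup_partialSups_eq b).symm
  rw [h2, primitive_iSup w (partialSups b).monotone]
  refine iSup_le fun n => ?_
  obtain ⟨j, -, hj⟩ := exists_partialSups_eq b n
  rw [hj]
  exact (primitive_two_pow_mul_le hD j (a j)).trans
    (ENNReal.le_tsum (f := fun j => (D : ℝ≥0∞) ^ j * primitive w (a j)) j)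

/-! ### Decreasing rearrangements, layer-cake formulas, strong and weak functionals. -/

section Rearrangement

variable {u : ℝ → ℝ} {g : ℝ → ℝ≥0∞}

/-- The infimum is attained: {g > s} is the increasing union of {g > v n} for v n decreasing to s,
and measures are continuous along increasing unions. -/
theorem rearrangement_le_iff {s : ℝ≥0∞} {t : ℝ} :
    rearrangement u g t ≤ s ↔ weightMeasure u {x | s < g x} ≤ ENNReal.ofReal t := by
  constructor
  · intro h
    rcases eq_or_ne s ∞ with rfl | hs
    · simp
    obtain ⟨v, hv, hvs, hlim⟩ := exists_seq_strictAnti_tendsto' (lt_top_iff_ne_top.2 hs)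
    have hU : {x | s < g x} = ⋃ n, {x | v n < g x} := by
      ext x
      simp only [mem_ofPred_eq, mem_iUnion]
      refine ⟨fun hx => ?_, fun ⟨n, hn⟩ => (hvs n).1.trans hn⟩
      exact (hlim.eventually (gt_mem_nhds hx)).exists
    rw [hU, Monotone.measure_iUnion]
    · refine iSup_le fun n => ?_
      obtain ⟨s', hs', hs'n⟩ := sInf_lt_iff.1 (h.trans_lt (hvs n).1)
      exact (measure_mono fun x (hx : v n < g x) => hs'n.trans hx).trans hs'.2
    · exact fun m n hmn x (hx : v m < g x) => (hv.antitone hmn).trans_lt hx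
  · intro h
    refine le_of_forall_gt_imp_ge_of_dense fun s' hs' => sInf_le ⟨pos_of_gt hs', ?_⟩
    exact (measure_mono fun x (hx : s' < g x) => hs'.trans hx).trans h

theorem lt_rearrangement_iff {s : ℝ≥0∞} {t : ℝ} :
    s < rearrangement u g t ↔ ENNReal.ofReal t < weightMeasure u {x | s < g x} := by
  simpa using (rearrangement_le_iff (u := u) (g := g) (s := s) (t := t)).not

theorem rearrangement_antitone : Antitone (rearrangement u g) := fun _ _ h =>
  rearrangement_le_iff.2 ((rearrangement_le_iff.1 le_rfl).trans (ENNReal.ofReal_le_ofReal h))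

theorem halfLineMeasure_lt_rearrangement (w : ℝ → ℝ) (s : ℝ≥0∞) :
    halfLineMeasure w {t | s < rearrangement u g t} =
      primitive w (weightMeasure u {x | s < g x}) := by
  simp only [lt_rearrangement_iff, halfLineMeasure_ofReal_lt]

/-- Layer-cake formula for functions with values in `[0, ∞]`. -/
theorem lintegral_rpow_eq_lintegral_meas_ofReal_lt {α : Type*} [MeasurableSpace α] (μ : Measure α)
    {h : α → ℝ≥0∞} (hh : Measurable h) {p : ℝ} (hp : 0 < p) :
    ∫⁻ x, h x ^ p ∂μ = ENNReal.ofReal p *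
      ∫⁻ s in Ioi (0 : ℝ), μ {x | ENNReal.ofReal s < h x} * ENNReal.ofReal (s ^ (p - 1)) := by
  have key : ∀ k : α → ℝ≥0∞, Measurable k → (∀ x, k x ≠ ∞) → ∫⁻ x, k x ^ p ∂μ = ENNReal.ofReal p *
      ∫⁻ s in Ioi (0 : ℝ), μ {x | ENNReal.ofReal s < k x} * ENNReal.ofReal (s ^ (p - 1)) := by
    intro k hk hk'
    have := lintegral_rpow_eq_lintegral_meas_lt_mul μ (f := fun x => (k x).toReal)
      (ae_of_all _ fun x => ENNReal.toReal_nonneg) hk.ennreal_toReal.aemeasurable hp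
    convert this using 2
    · ext x
      rw [← ENNReal.ofReal_rpow_of_nonneg ENNReal.toReal_nonneg hp.le,
        ENNReal.ofReal_toReal (hk' x)]
    · refine setLIntegral_congr_fun measurableSet_Ioi fun s hs => ?_
      simp only [ENNReal.ofReal_lt_iff_lt_toReal (le_of_lt hs) (hk' _)]
  -- The value ∞ is reached by truncating at n and using monotone convergence on both sides.
  have hmono : ∀ x, Monotone fun n : ℕ => min (h x) n := fun x m n hmn =>
    min_le_min_left _ (by exact_mod_cast hmn)
  have hsup : ∀ x, ⨆ n : ℕ, min (h x) n = h x := fun x => by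
    rw [← inf_iSup_eq, ENNReal.iSup_natCast, inf_top_eq]
  calc ∫⁻ x, h x ^ p ∂μ = ∫⁻ x, ⨆ n : ℕ, min (h x) n ^ p ∂μ := by
        congr 1; ext x
        conv_lhs => rw [← hsup x]
        exact (ENNReal.orderIsoRpow p hp).map_iSup _
    _ = ⨆ n : ℕ, ∫⁻ x, min (h x) n ^ p ∂μ := lintegral_iSup
        (fun n => (hh.min measurable_const).pow_const p)
        (fun m n hmn x => ENNReal.rpow_le_rpow (hmono x hmn) hp.le)
    _ = ⨆ n : ℕ, ENNReal.ofReal p * ∫⁻ s in Ioi (0 : ℝ),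
          μ {x | ENNReal.ofReal s < min (h x) n} * ENNReal.ofReal (s ^ (p - 1)) := by
        congr 1; ext n
        exact key _ (hh.min measurable_const)
          fun x => ((min_le_right _ _).trans_lt (ENNReal.natCast_lt_top n)).ne
    _ = _ := by
        rw [← ENNReal.mul_iSup, ← lintegral_iSup']
        · congr 2; ext s
          rw [← ENNReal.iSup_mul, ← Monotone.measure_iUnion]
          · congr 2
            ext x
            simp only [mem_iUnion, mem_ofPred_eq]
            rw [← lt_iSup_iff, hsup]
          · exact fun m n hmn x hx => lt_of_lt_of_le hx (hmono x hmn)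
        · intro n
          refine (Measurable.mul (Antitone.measurable ?_) (by fun_prop)).aemeasurable
          exact fun s s' hs => measure_mono fun x hx =>
            lt_of_le_of_lt (ENNReal.ofReal_le_ofReal hs) hx
        · refine ae_of_all _ fun s m n hmn => ?_
          dsimp only
          gcongr 1
          exact measure_mono fun x hx => lt_of_lt_of_le hx (hmono x hmn)

variable {w : ℝ → ℝ} {p : ℝ}

theorem lorentzNorm_rpow (hw : AEMeasurable w (volume.restrict (Ioi 0))) (hp : 0 < p) :
    lorentzNorm p u w g ^ p = ∫⁻ t, rearrangement u g t ^ p ∂halfLineMeasure w := by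
  rw [lorentzNorm, ← ENNReal.rpow_mul, one_div_mul_cancel hp.ne', ENNReal.rpow_one, halfLineMeasure,
    lintegral_withDensity_eq_lintegral_mul₀ hw.ennreal_ofReal
      (rearrangement_antitone.measurable.pow_const p).aemeasurable]
  simp [mul_comm]

theorem lorentzNorm_rpow_eq_layercake (hw : AEMeasurable w (volume.restrict (Ioi 0)))
    (hp : 0 < p) :
    lorentzNorm p u w g ^ p = ENNReal.ofReal p * ∫⁻ s in Ioi (0 : ℝ),
      primitive w (weightMeasure u {x | ENNReal.ofReal s < g x}) * ENNReal.ofReal (s ^ (p - 1)) := by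
  rw [lorentzNorm_rpow hw hp,
    lintegral_rpow_eq_lintegral_meas_ofReal_lt _ rearrangement_antitone.measurable hp]
  simp only [halfLineMeasure_lt_rearrangement]

theorem weakLorentzNorm_le_lorentzNorm (hw : AEMeasurable w (volume.restrict (Ioi 0)))
    (hp : 0 < p) : weakLorentzNorm p u w g ≤ lorentzNorm p u w g := by
  refine iSup₂_le fun t ht => ?_
  rw [← ENNReal.rpow_le_rpow_iff hp, ENNReal.mul_rpow_of_nonneg _ _ hp.le, ← ENNReal.rpow_mul,
    one_div_mul_cancel hp.ne', ENNReal.rpow_one, lorentzNorm_rpow hw hp,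
    ← halfLineMeasure_ofReal_lt, ← setLIntegral_const]
  refine (setLIntegral_mono (rearrangement_antitone.measurable.pow_const p) fun s hs => ?_).trans
    (setLIntegral_le_lintegral _ _)
  exact ENNReal.rpow_le_rpow
    (rearrangement_antitone ((ENNReal.ofReal_lt_ofReal_iff ht).1 hs).le) hp.le

/-- The measure a of {g > s} may be infinite, and g*_u(t) > s only for t < a. Hence a is approached
strictly from below by finite t, and left continuity of W gives the limit. -/
theorem rpow_mul_primitive_le_weakLorentzNorm_rpow (hp : 0 < p) (s : ℝ≥0∞) :
    s ^ p * primitive w (weightMeasure u {x | s < g x}) ≤ weakLorentzNorm p u w g ^ p := by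
  set a := weightMeasure u {x | s < g x} with ha
  rcases eq_or_ne a 0 with h0 | h0
  · simp [h0, primitive_zero]
  obtain ⟨v, hv, hva, hlim⟩ := exists_seq_strictMono_tendsto' (pos_iff_ne_zero.2 h0)
  have hsup : ⨆ n, v n = a := iSup_eq_of_tendsto hv.monotone hlim
  rw [← hsup, primitive_iSup w hv.monotone, ENNReal.mul_iSup]
  refine iSup_le fun n => ?_
  have hvt : v n ≠ ∞ := (hva n).2.ne_top
  have h1 : s < rearrangement u g (v n).toReal := by
    rw [lt_rearrangement_iff, ENNReal.ofReal_toReal hvt]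
    exact (hva n).2
  have h2 : s * primitive w (v n) ^ (1 / p) ≤ weakLorentzNorm p u w g := by
    refine le_trans ?_ (le_iSup₂ (v n).toReal (ENNReal.toReal_pos (hva n).1.ne' hvt))
    rw [ENNReal.ofReal_toReal hvt]
    gcongr
  have h3 := ENNReal.rpow_le_rpow h2 hp.le
  rwa [ENNReal.mul_rpow_of_nonneg _ _ hp.le, ← ENNReal.rpow_mul, one_div_mul_cancel hp.ne',
    ENNReal.rpow_one] at h3

/-- Bound of the Lorentz norm of a function controlled by steps along increasing sets. -/
theorem lorentzNorm_rpow_le_sum (hw : AEMeasurable w (volume.restrict (Ioi 0))) (hp : 0 < p)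
    {n : ℕ} {T : ℕ → Set ℝ} (hT : Monotone T) {b : ℕ → ℝ≥0∞}
    (hb : ∀ k < n, ∀ x, (∀ j < k, x ∉ T j) → g x ≤ b k)
    (h0 : ∀ x, (∀ j < n, x ∉ T j) → g x = 0) :
    lorentzNorm p u w g ^ p ≤
      ∑ k ∈ Finset.range n, b k ^ p * primitive w (weightMeasure u (T k)) := by
  have hpt : ∀ t : ℝ, rearrangement u g t ^ p ≤ ∑ k ∈ Finset.range n,
      {t | ENNReal.ofReal t < weightMeasure u (T k)}.indicator (fun _ => b k ^ p) t := by
    intro t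
    have hT' : ∀ k, (∀ j < k, weightMeasure u (T j) ≤ ENNReal.ofReal t) →
        weightMeasure u {x | ∃ j < k, x ∈ T j} ≤ ENNReal.ofReal t := by
      intro k hk
      cases k with
      | zero => simp
      | succ k =>
        refine (measure_mono ?_).trans (hk k (Nat.lt_succ_self k))
        rintro x ⟨j, hj, hx⟩
        exact hT (Nat.lt_succ_iff.1 hj) hx
    -- For the first k with u(T k) > t, the set {g > b k} lies in the union of the earlier T j,
    -- whose measure is at most t; so the rearrangement at t is at most b k.
    by_cases hk : ∃ k, k < n ∧ ENNReal.ofReal t < weightMeasure u (T k)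
    · classical
      obtain ⟨hkn, hkt⟩ := Nat.find_spec hk
      set k := Nat.find hk
      have hmin : ∀ j < k, weightMeasure u (T j) ≤ ENNReal.ofReal t := fun j hj => by
        have := Nat.find_min hk hj
        push Not at this
        exact this (hj.trans hkn)
      have h1 : rearrangement u g t ≤ b k := by
        refine rearrangement_le_iff.2 ((measure_mono fun x hx => ?_).trans (hT' k hmin))
        by_contra hne
        simp only [mem_ofPred_eq, not_exists, not_and] at hne
        exact (hb k hkn x hne).not_gt hx
      refine (ENNReal.rpow_le_rpow h1 hp.le).trans ?_
      refine le_trans (le_of_eq ?_) (Finset.single_le_sum (fun _ _ => bot_le)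
        (Finset.mem_range.2 hkn))
      rw [indicator_of_mem]
      exact hkt
    · push Not at hk
      have h1 : rearrangement u g t ≤ 0 := by
        refine rearrangement_le_iff.2 ((measure_mono fun x hx => ?_).trans (hT' n hk))
        by_contra hne
        simp only [mem_ofPred_eq, not_exists, not_and] at hne
        simp [h0 x hne] at hx
      rw [nonpos_iff_eq_zero.1 h1, ENNReal.zero_rpow_of_pos hp]
      exact bot_le
  rw [lorentzNorm_rpow hw hp]
  have hm : ∀ k, MeasurableSet {t : ℝ | ENNReal.ofReal t < weightMeasure u (T k)} := fun k =>
    measurableSet_lt ENNReal.measurable_ofReal measurable_const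
  refine (lintegral_mono hpt).trans (le_of_eq ?_)
  rw [lintegral_finsetSum _ fun k _ => measurable_const.indicator (hm k)]
  refine Finset.sum_congr rfl fun k _ => ?_
  rw [lintegral_indicator_const (hm k), halfLineMeasure_ofReal_lt]

end Rearrangement

/-! ### Density sets and the reverse weak-type estimate. -/

/-- The points lying in a nondegenerate compact interval in which `E` has density more than `l`. -/
def denseSet (E : Set ℝ) (l : ℝ) : Set ℝ :=
  {x | ∃ a b : ℝ, a < b ∧ x ∈ Icc a b ∧ ENNReal.ofReal (l * (b - a)) < volume (E ∩ Icc a b)}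

theorem ofReal_lt_maximalFunction_iff {f : ℝ → ℝ} {s : ℝ} (hs : 0 ≤ s) {x : ℝ} :
    ENNReal.ofReal s < maximalFunction f x ↔ ∃ a b : ℝ, a < b ∧ x ∈ Icc a b ∧
      ENNReal.ofReal (s * (b - a)) < ∫⁻ y in Icc a b, ‖f y‖ₑ := by
  simp only [maximalFunction, lt_iSup_iff, exists_prop]
  refine exists_congr fun a => exists_congr fun b => and_congr_right fun hab =>
    and_congr_right fun _ => ?_
  rw [Real.volume_Icc, ENNReal.lt_div_iff_mul_lt
    (Or.inl (by simpa using hab)) (Or.inl ENNReal.ofReal_ne_top), ENNReal.ofReal_mul hs]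

theorem denseSet_mono {E F : Set ℝ} (h : E ⊆ F) (l : ℝ) : denseSet E l ⊆ denseSet F l :=
  fun _ ⟨a, b, hab, hx, hl⟩ =>
    ⟨a, b, hab, hx, hl.trans_le (measure_mono (inter_subset_inter_left _ h))⟩

theorem denseSet_anti (E : Set ℝ) : Antitone (denseSet E) :=
  fun _ _ h _ ⟨a, b, hab, hx, hl⟩ => ⟨a, b, hab, hx,
    (ENNReal.ofReal_le_ofReal (mul_le_mul_of_nonneg_right h (sub_pos.2 hab).le)).trans_lt hl⟩

/-- The strict density inequality survives a slight enlargement of the interval on both sides, for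
an arbitrary set E. -/
theorem isOpen_denseSet (E : Set ℝ) (l : ℝ) : IsOpen (denseSet E l) := by
  rw [isOpen_iff_mem_nhds]
  rintro x ⟨a, b, hab, hx, h⟩
  have hc : ContinuousAt (fun ε : ℝ => ENNReal.ofReal (l * ((b + ε) - (a - ε)))) 0 :=
    ENNReal.continuous_ofReal.continuousAt.comp (by fun_prop)
  have h0 : ∀ᶠ ε in 𝓝[>] (0 : ℝ), ENNReal.ofReal (l * ((b + ε) - (a - ε))) < volume (E ∩ Icc a b) :=
    (hc.eventually (gt_mem_nhds (by simpa using h))).filter_mono nhdsWithin_le_nhds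
  obtain ⟨ε, hε, hε0⟩ := (h0.and self_mem_nhdsWithin).exists
  have hε0 : 0 < ε := hε0
  filter_upwards [Icc_mem_nhds (by linarith [hx.1] : a - ε < x) (by linarith [hx.2] : x < b + ε)]
    with y hy
  exact ⟨a - ε, b + ε, by linarith, hy, hε.trans_le (measure_mono (inter_subset_inter_right _
    (Icc_subset_Icc (by linarith) (by linarith))))⟩

/-- Almost every point of `E` is a point of density. -/
theorem volume_diff_denseSet (E : Set ℝ) {l : ℝ} (hl : l < 1) :
    volume (E \ denseSet E l) = 0 := by
  have h : ∀ᵐ x ∂volume.restrict E, x ∈ denseSet E l := by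
    filter_upwards [Besicovitch.ae_tendsto_measure_inter_div (volume : Measure ℝ) E] with x hx
    have h1 : ∀ᶠ r in 𝓝[>] (0 : ℝ), ENNReal.ofReal l <
        volume (E ∩ Metric.closedBall x r) / volume (Metric.closedBall x r) :=
      hx.eventually (lt_mem_nhds (by simpa using hl))
    obtain ⟨r, hr, hr0⟩ := (h1.and self_mem_nhdsWithin).exists
    have hr0 : 0 < r := hr0
    rw [Real.closedBall_eq_Icc, Real.volume_Icc, ENNReal.lt_div_iff_mul_lt
      (Or.inl (by simp; linarith)) (Or.inl ENNReal.ofReal_ne_top),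
      ← ENNReal.ofReal_mul' (by linarith)] at hr
    exact ⟨x - r, x + r, by linarith, ⟨by linarith, by linarith⟩, hr⟩
  have h2 : volume.restrict E (denseSet E l)ᶜ = 0 := h
  rw [Measure.restrict_apply (isOpen_denseSet E l).measurableSet.compl] at h2
  rwa [sdiff_eq, inter_comm]

/-- Reverse weak-type estimate. -/
theorem volume_le_five_mul_denseSet {E : Set ℝ} {l : ℝ} (hl : 0 < l) (hl1 : l < 1) {a b : ℝ}
    (hU : denseSet E l ⊆ Icc a b) : volume E ≤ ENNReal.ofReal (5 * l) * volume (denseSet E l) := by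
  set U := denseSet E l with hUdef
  have hUo : IsOpen U := isOpen_denseSet E l
  have hy0 : max a b + 1 ∈ Uᶜ := fun h => by
    have := (hU h).2
    linarith [le_max_right a b]
  -- Whitney-type balls: the ball of radius r x stays in U, while its five-fold enlargement reaches
  -- a point outside U and therefore meets E with density at most l.
  set r : ℝ → ℝ := fun x => Metric.infDist x Uᶜ with hr
  have hr0 : ∀ x ∈ U, 0 < r x := fun x hx =>
    (hUo.isClosed_compl.notMem_iff_infDist_pos ⟨_, hy0⟩).1 fun h => h hx
  have hball : ∀ x, Metric.ball x (r x) ⊆ U := fun x => Metric.ball_infDist_compl_subset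
  have hrR : ∀ x ∈ U, r x ≤ max a b + 1 - a := fun x hx => by
    refine (Metric.infDist_le_dist_of_mem hy0).trans ?_
    have h1 := hU hx
    rw [Real.dist_eq, abs_sub_comm, abs_of_nonneg (by linarith [h1.2, le_max_right a b])]
    linarith [h1.1]
  obtain ⟨v, hvU, hvd, hcov⟩ := Vitali.exists_disjoint_subfamily_covering_enlargement_closedBall
    U id r _ hrR 5 (by norm_num)
  have hvc : v.Countable := hvd.countable_of_nonempty_interior fun x hx =>
    ⟨x, Metric.ball_subset_interior_closedBall (Metric.mem_ball_self (hr0 x (hvU hx)))⟩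
  have hsmall : ∀ x ∈ v, volume (E ∩ Metric.closedBall x (5 * r x)) ≤
      ENNReal.ofReal (5 * l) * volume (Metric.ball x (r x)) := by
    intro x hx
    have hx0 := hr0 x (hvU hx)
    obtain ⟨y, hy, hyd⟩ := hUo.isClosed_compl.exists_infDist_eq_dist ⟨_, hy0⟩ x
    have hyd : r x = dist x y := hyd
    by_contra! hlt
    refine hy ⟨x - 5 * r x, x + 5 * r x, by linarith, ?_, ?_⟩
    · rw [← Real.closedBall_eq_Icc, Metric.mem_closedBall, dist_comm, ← hyd]
      linarith
    · rw [← Real.closedBall_eq_Icc]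
      refine lt_of_eq_of_lt ?_ hlt
      rw [Real.volume_ball, ← ENNReal.ofReal_mul (by positivity)]
      congr 1
      ring
  calc volume E ≤ volume (E ∩ U) + volume (E \ U) := measure_le_inter_add_sdiff _ _ _
    _ = volume (E ∩ U) := by rw [volume_diff_denseSet E hl1, add_zero]
    _ ≤ volume (⋃ x ∈ v, E ∩ Metric.closedBall x (5 * r x)) := by
        refine measure_mono fun x hx => ?_
        obtain ⟨y, hy, hxy⟩ := hcov x hx.2
        exact mem_biUnion hy ⟨hx.1, hxy (Metric.mem_closedBall_self (hr0 x hx.2).le)⟩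
    _ ≤ ∑' x : v, volume (E ∩ Metric.closedBall (x : ℝ) (5 * r x)) := measure_biUnion_le _ hvc _
    _ ≤ ∑' x : v, ENNReal.ofReal (5 * l) * volume (Metric.ball (x : ℝ) (r x)) :=
        ENNReal.tsum_le_tsum fun x => hsmall x x.2
    _ = ENNReal.ofReal (5 * l) * volume (⋃ x ∈ v, Metric.ball x (r x)) := by
        rw [ENNReal.tsum_mul_left, measure_biUnion hvc _ fun _ _ => Metric.isOpen_ball.measurableSet]
        exact hvd.mono_on fun x _ => Metric.ball_subset_closedBall
    _ ≤ ENNReal.ofReal (5 * l) * volume U := by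
        gcongr
        exact iUnion₂_subset fun x _ => hball x

/-- If `E` has density at least `l * m` in an interval, then `denseSet E l` has density at least a
multiple of `m` in the tripled interval. -/
theorem le_volume_denseSet_inter {E : Set ℝ} {l m a b : ℝ} (hl : 0 < l) (hl1 : l < 1)
    (hm1 : m ≤ 1) (hab : a < b)
    (hE : ENNReal.ofReal (l * m * (b - a)) ≤ volume (E ∩ Icc a b)) :
    ENNReal.ofReal (m * (b - a) / 5) ≤
      volume (denseSet E l ∩ Icc (a - (b - a)) (b + (b - a))) := by
  have hba : 0 < b - a := sub_pos.2 hab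
  -- If E has density more than l in the interval, the whole interval lies in the density set.
  -- Otherwise any interval where F below has density more than l is shorter than b - a and meets
  -- the original one, so it stays in the tripled interval and the reverse estimate applies to F.
  rcases lt_or_ge (ENNReal.ofReal (l * (b - a))) (volume (E ∩ Icc a b)) with h | h
  · have hsub : Icc a b ⊆ denseSet E l ∩ Icc (a - (b - a)) (b + (b - a)) := fun x hx =>
      ⟨⟨a, b, hab, hx, h⟩, by linarith [hx.1], by linarith [hx.2]⟩
    refine le_trans ?_ (measure_mono hsub)
    rw [Real.volume_Icc]
    apply ENNReal.ofReal_le_ofReal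
    nlinarith
  · set F := E ∩ Icc a b
    have hsub : denseSet F l ⊆ Icc (a - (b - a)) (b + (b - a)) := by
      rintro x ⟨c, d, hcd, hx, hlt⟩
      have h1 : d - c < b - a := by
        have := hlt.trans_le ((measure_mono inter_subset_left).trans h)
        rw [ENNReal.ofReal_lt_ofReal_iff (by positivity)] at this
        exact lt_of_mul_lt_mul_left this hl.le
      obtain ⟨y, hyF, hy⟩ : (F ∩ Icc c d).Nonempty := by
        rw [nonempty_iff_ne_empty]
        intro h0
        simp [h0] at hlt
      have hyab := hyF.2
      exact ⟨by linarith [hx.1, hx.2, hy.1, hy.2, hyab.1],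
        by linarith [hx.1, hx.2, hy.1, hy.2, hyab.2]⟩
    have h2 := hE.trans (volume_le_five_mul_denseSet hl hl1 hsub)
    have h3 : volume (denseSet F l) ≤ volume (denseSet E l ∩ Icc (a - (b - a)) (b + (b - a))) :=
      measure_mono fun x hx => ⟨denseSet_mono inter_subset_left l hx, hsub hx⟩
    refine le_trans ?_ h3
    have h4 : l * m * (b - a) = (5 * l) * (m * (b - a) / 5) := by ring
    rw [h4, ENNReal.ofReal_mul (by positivity)] at h2
    exact (ENNReal.mul_le_mul_iff_right (by simpa using hl) ENNReal.ofReal_ne_top).1 h2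

/-- Tripling the interval turns a mass m(b - a)/5 into a density m/15, and m/16 makes the inequality
strict. -/
theorem denseSet_mul_subset (E : Set ℝ) {l m : ℝ} (hl : 0 < l) (hl1 : l < 1) (hm : 0 < m)
    (hm1 : m ≤ 1) : denseSet E (l * m) ⊆ denseSet (denseSet E l) (m / 16) := by
  rintro x ⟨a, b, hab, hx, h⟩
  have hba : 0 < b - a := sub_pos.2 hab
  refine ⟨a - (b - a), b + (b - a), by linarith, ⟨by linarith [hx.1], by linarith [hx.2]⟩,
    lt_of_lt_of_le ?_ (le_volume_denseSet_inter hl hl1 hm1 hab h.le)⟩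
  rw [ENNReal.ofReal_lt_ofReal_iff (by positivity)]
  nlinarith [mul_pos hm hba]

/-! ### The ladder function and its maximal function. -/

/-- The weighted superposition of the sets of density more than `2⁻¹, …, 2⁻ⁿ`. -/
noncomputable def densityLadder (E : Set ℝ) (n : ℕ) (x : ℝ) : ℝ :=
  ∑ k ∈ Finset.range n,
    (denseSet E ((1 / 2) ^ (k + 1))).indicator (fun _ => 2 ^ (n - 1 - k) / (n : ℝ)) x

theorem measurable_densityLadder (E : Set ℝ) (n : ℕ) : Measurable (densityLadder E n) :=
  Finset.measurable_sum _ fun _ _ =>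
    measurable_const.indicator (isOpen_denseSet E _).measurableSet

theorem enorm_densityLadder (E : Set ℝ) (n : ℕ) (x : ℝ) :
    ‖densityLadder E n x‖ₑ = ∑ k ∈ Finset.range n, (denseSet E ((1 / 2) ^ (k + 1))).indicator
      (fun _ => ENNReal.ofReal (2 ^ (n - 1 - k) / (n : ℝ))) x := by
  have h0 : ∀ k, 0 ≤ (denseSet E ((1 / 2) ^ (k + 1))).indicator
      (fun _ => 2 ^ (n - 1 - k) / (n : ℝ)) x := fun k =>
    indicator_nonneg (fun _ _ => by positivity) x
  rw [densityLadder, Real.enorm_of_nonneg (Finset.sum_nonneg fun k _ => h0 k),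
    ENNReal.ofReal_sum_of_nonneg fun k _ => h0 k]
  refine Finset.sum_congr rfl fun k _ => ?_
  by_cases hx : x ∈ denseSet E ((1 / 2) ^ (k + 1))
  · simp only [indicator_of_mem hx]
  · simp only [indicator_of_notMem hx, ENNReal.ofReal_zero]

/-- Writing 2^(-n) = 2^(-(k+1)) 2^(-(n-1-k)), rung k has mass at least 2^(-(n-1-k)) (b - a)/5 in the
tripled interval, and its weight cancels the power of 2. The n rungs together give (b - a)/5, which
exceeds 1/16 of the tripled length. -/
theorem denseSet_subset_lt_maximalFunction_densityLadder (E : Set ℝ) {n : ℕ} (hn : 1 ≤ n) :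
    denseSet E ((1 / 2) ^ n) ⊆
      {x | ENNReal.ofReal (1 / 16) < maximalFunction (densityLadder E n) x} := by
  rintro x ⟨a, b, hab, hx, h⟩
  have hba : 0 < b - a := sub_pos.2 hab
  have hn0 : (0 : ℝ) < n := by exact_mod_cast hn
  rw [mem_ofPred_eq, ofReal_lt_maximalFunction_iff (by norm_num)]
  refine ⟨a - (b - a), b + (b - a), by linarith, ⟨by linarith [hx.1], by linarith [hx.2]⟩, ?_⟩
  have h1 : ∀ k ∈ Finset.range n, ENNReal.ofReal ((b - a) / (5 * n)) ≤
      ENNReal.ofReal (2 ^ (n - 1 - k) / (n : ℝ)) *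
        volume (denseSet E ((1 / 2) ^ (k + 1)) ∩ Icc (a - (b - a)) (b + (b - a))) := by
    intro k hk
    have hk' : k < n := Finset.mem_range.1 hk
    have hpow : ((1 : ℝ) / 2) ^ n = (1 / 2) ^ (k + 1) * (1 / 2) ^ (n - 1 - k) := by
      rw [← pow_add]
      congr 1
      omega
    rw [hpow] at h
    refine le_trans (le_of_eq ?_) (mul_le_mul_right (le_volume_denseSet_inter (by positivity)
      (pow_lt_one₀ (by norm_num) (by norm_num) (by omega))
      (pow_le_one₀ (by norm_num) (by norm_num)) hab h.le) _)
    rw [← ENNReal.ofReal_mul (by positivity)]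
    congr 1
    have : (2 : ℝ) ^ (n - 1 - k) * (1 / 2) ^ (n - 1 - k) = 1 := by
      rw [← mul_pow]; norm_num
    field_simp
    linear_combination -this
  calc ENNReal.ofReal (1 / 16 * (b + (b - a) - (a - (b - a)))) < ENNReal.ofReal ((b - a) / 5) := by
        rw [ENNReal.ofReal_lt_ofReal_iff (by positivity)]
        linarith
    _ = ∑ k ∈ Finset.range n, ENNReal.ofReal ((b - a) / (5 * n)) := by
        rw [Finset.sum_const, Finset.card_range, nsmul_eq_mul, ← ENNReal.ofReal_natCast,
          ← ENNReal.ofReal_mul hn0.le]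
        congr 1
        field_simp
    _ ≤ _ := Finset.sum_le_sum h1
    _ = _ := by
        simp only [enorm_densityLadder]
        rw [lintegral_finsetSum _ fun k _ =>
          measurable_const.indicator (isOpen_denseSet E _).measurableSet]
        refine Finset.sum_congr rfl fun k _ => ?_
        rw [lintegral_indicator_const (isOpen_denseSet E _).measurableSet,
          Measure.restrict_apply (isOpen_denseSet E _).measurableSet]

theorem denseSet_subset_lt_maximalFunction_indicator {E : Set ℝ} (hE : NullMeasurableSet E volume)
    {l : ℝ} (hl : 0 ≤ l) :
    denseSet E l ⊆ {x | ENNReal.ofReal l < maximalFunction (E.indicator 1) x} := by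
  rintro x ⟨a, b, hab, hx, h⟩
  rw [mem_ofPred_eq, ofReal_lt_maximalFunction_iff hl]
  refine ⟨a, b, hab, hx, h.trans_le (le_of_eq ?_)⟩
  have h1 : ∀ y, ‖E.indicator (1 : ℝ → ℝ) y‖ₑ = E.indicator (fun _ => (1 : ℝ≥0∞)) y := fun y => by
    by_cases hy : y ∈ E
    · simp [indicator_of_mem hy]
    · simp [indicator_of_notMem hy]
  simp only [h1]
  rw [lintegral_indicator₀ (hE.mono_ac Measure.restrict_le_self.absolutelyContinuous),
    setLIntegral_const, one_mul, Measure.restrict_apply₀' measurableSet_Icc.nullMeasurableSet]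

/-! ### Restricted weak-type estimates from weak boundedness, and their self-improvement. -/

section WeakBounded

variable {p : ℝ} {u w : ℝ → ℝ}

theorem WeakBounded.exists_one_le (h : WeakBounded p u w) :
    ∃ C : ℝ≥0, 1 ≤ C ∧ ∀ f : ℝ → ℝ, MemLorentz p u w f →
      weakLorentzNorm p u w (maximalFunction f) ≤ C * lorentzNorm p u w (fun x => ‖f x‖ₑ) := by
  obtain ⟨C, hC⟩ := h
  refine ⟨max 1 C, le_max_left _ _, fun f hf => (hC f hf).trans ?_⟩
  gcongr
  exact le_max_right _ _

/-- Weak-type boundedness on one superlevel set. -/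
theorem rpow_mul_primitive_superlevel_le (hp : 0 < p) {C : ℝ≥0}
    (hC : ∀ f : ℝ → ℝ, MemLorentz p u w f →
      weakLorentzNorm p u w (maximalFunction f) ≤ C * lorentzNorm p u w (fun x => ‖f x‖ₑ))
    {f : ℝ → ℝ} (hf : AEMeasurable f volume) {K : ℝ≥0∞} (hK : K ≠ ∞)
    (hfK : lorentzNorm p u w (fun x => ‖f x‖ₑ) ^ p ≤ K) (s : ℝ≥0∞) :
    s ^ p * primitive w (weightMeasure u {x | s < maximalFunction f x}) ≤ (C : ℝ≥0∞) ^ p * K := by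
  have hfin : lorentzNorm p u w (fun x => ‖f x‖ₑ) < ∞ :=
    (ENNReal.rpow_lt_top_iff_of_pos hp).1 (hfK.trans_lt hK.lt_top)
  refine (rpow_mul_primitive_le_weakLorentzNorm_rpow hp s).trans ?_
  refine (ENNReal.rpow_le_rpow (hC f ⟨hf, hfin⟩) hp.le).trans ?_
  rw [ENNReal.mul_rpow_of_nonneg _ _ hp.le]
  gcongr

/-- Restricted weak type of exponent `p`. -/
theorem rpow_mul_primitive_denseSet_le (hw : AEMeasurable w (volume.restrict (Ioi 0)))
    (hp : 0 < p) {C : ℝ≥0} (hC1 : 1 ≤ C)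
    (hC : ∀ f : ℝ → ℝ, MemLorentz p u w f →
      weakLorentzNorm p u w (maximalFunction f) ≤ C * lorentzNorm p u w (fun x => ‖f x‖ₑ))
    {E : Set ℝ} (hE : NullMeasurableSet E volume) {l : ℝ} (hl : 0 < l) :
    ENNReal.ofReal l ^ p * primitive w (weightMeasure u (denseSet E l)) ≤
      (C : ℝ≥0∞) ^ p * primitive w (weightMeasure u E) := by
  have hC0 : (C : ℝ≥0∞) ^ p ≠ 0 := by
    have : (C : ℝ≥0∞) ≠ 0 := by
      simpa using (zero_lt_one.trans_le hC1).ne'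
    simp [ENNReal.rpow_eq_zero_iff, this]
  -- With W(u(E)) infinite the indicator need not belong to the Lorentz class, but then the
  -- right-hand side is infinite.
  rcases eq_or_ne (primitive w (weightMeasure u E)) ∞ with htop | htop
  · rw [htop, ENNReal.mul_top hC0]
    exact le_top
  have hm : AEMeasurable (E.indicator (1 : ℝ → ℝ)) volume :=
    (aemeasurable_indicator_const_iff (1 : ℝ)).2 hE
  have hnorm : lorentzNorm p u w (fun x => ‖E.indicator (1 : ℝ → ℝ) x‖ₑ) ^ p ≤
      primitive w (weightMeasure u E) := by
    refine (lorentzNorm_rpow_le_sum hw hp (n := 1) (T := fun _ => E) (b := fun _ => 1)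
      monotone_const ?_ ?_).trans ?_
    · intro k _ x _
      by_cases hx : x ∈ E
      · simp [indicator_of_mem hx]
      · simp [indicator_of_notMem hx]
    · intro x hx
      simp [indicator_of_notMem (hx 0 one_pos)]
    · simp
  refine le_trans ?_ (rpow_mul_primitive_superlevel_le hp hC hm htop hnorm (ENNReal.ofReal l))
  gcongr
  exact primitive_mono w (measure_mono (denseSet_subset_lt_maximalFunction_indicator hE hl.le))

/-- Only the rungs k, ..., n - 1 survive at x, and their weights form a geometric sum. -/
theorem enorm_densityLadder_le {E : Set ℝ} {n k : ℕ} (hk : k < n) {x : ℝ}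
    (hx : ∀ j < k, x ∉ denseSet E ((1 / 2) ^ (j + 1))) :
    ‖densityLadder E n x‖ₑ ≤ ENNReal.ofReal (2 ^ (n - k) / n) := by
  have hn0 : (0 : ℝ) < n := by exact_mod_cast (Nat.zero_le k).trans_lt hk
  have h0 : ∀ k, 0 ≤ (denseSet E ((1 / 2) ^ (k + 1))).indicator
      (fun _ => 2 ^ (n - 1 - k) / (n : ℝ)) x := fun k =>
    indicator_nonneg (fun _ _ => by positivity) x
  rw [Real.enorm_of_nonneg (show 0 ≤ densityLadder E n x from Finset.sum_nonneg fun k _ => h0 k)]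
  apply ENNReal.ofReal_le_ofReal
  have h1 : densityLadder E n x ≤ ∑ j ∈ Finset.Ico k n, 2 ^ (n - 1 - j) / (n : ℝ) := by
    rw [densityLadder, Finset.range_eq_Ico, ← Finset.sum_Ico_consecutive _ (Nat.zero_le k) hk.le,
      Finset.sum_eq_zero, zero_add]
    · refine Finset.sum_le_sum fun j _ => ?_
      refine indicator_le_self' (fun _ _ => ?_) x
      positivity
    · intro j hj
      exact indicator_of_notMem (hx j (Finset.mem_Ico.1 hj).2) _
  refine h1.trans ?_
  rw [← Finset.sum_div]
  gcongr
  rw [Finset.sum_Ico_eq_sum_range]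
  have h2 : ∀ i ∈ Finset.range (n - k), (2 : ℝ) ^ (n - 1 - (k + i)) = 2 ^ (n - k - 1 - i) :=
    fun i _ => by congr 1; omega
  rw [Finset.sum_congr rfl h2, Finset.sum_range_reflect (fun i => (2 : ℝ) ^ i), geom_sum_eq
    (by norm_num)]
  norm_num

/-- The restricted estimate at density 2^(-(k+1)) costs 2^((k+1)p), exactly balancing the height
2^(n-k)/n. All n steps obey the same bound, and n · n^(-p) is the source of the logarithmic gain. -/
theorem lorentzNorm_densityLadder_rpow_le (hw : AEMeasurable w (volume.restrict (Ioi 0)))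
    (hp : 0 < p) {C : ℝ≥0} (hC1 : 1 ≤ C)
    (hC : ∀ f : ℝ → ℝ, MemLorentz p u w f →
      weakLorentzNorm p u w (maximalFunction f) ≤ C * lorentzNorm p u w (fun x => ‖f x‖ₑ))
    {E : Set ℝ} (hE : NullMeasurableSet E volume) (n : ℕ) :
    lorentzNorm p u w (fun x => ‖densityLadder E n x‖ₑ) ^ p ≤
      n * ENNReal.ofReal (2 ^ (n + 1) / n) ^ p *
        ((C : ℝ≥0∞) ^ p * primitive w (weightMeasure u E)) := by
  refine (lorentzNorm_rpow_le_sum hw hp (n := n) (T := fun k => denseSet E ((1 / 2) ^ (k + 1)))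
    (b := fun k => ENNReal.ofReal (2 ^ (n - k) / n)) ?_ ?_ ?_).trans ?_
  · exact fun i j hij => denseSet_anti E
      (pow_le_pow_of_le_one (by norm_num) (by norm_num) (by omega))
  · exact fun k hk x hx => enorm_densityLadder_le hk hx
  · intro x hx
    rw [enorm_densityLadder]
    exact Finset.sum_eq_zero fun k hk => indicator_of_notMem (hx k (Finset.mem_range.1 hk)) _
  · have h1 : ∀ k ∈ Finset.range n, ENNReal.ofReal (2 ^ (n - k) / n) ^ p *
        primitive w (weightMeasure u (denseSet E ((1 / 2) ^ (k + 1)))) ≤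
        ENNReal.ofReal (2 ^ (n + 1) / n) ^ p *
          ((C : ℝ≥0∞) ^ p * primitive w (weightMeasure u E)) := by
      intro k hk
      have hk : k < n := Finset.mem_range.1 hk
      refine le_trans (le_of_eq ?_) (mul_le_mul_right
        (rpow_mul_primitive_denseSet_le hw hp hC1 hC hE (l := (1 / 2) ^ (k + 1)) (by positivity)) _)
      rw [← mul_assoc, ← ENNReal.mul_rpow_of_nonneg _ _ hp.le, ← ENNReal.ofReal_mul (by positivity)]
      congr 3
      have h2 : (2 : ℝ) ^ (n + 1) = 2 ^ (n - k) * 2 ^ (k + 1) := by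
        rw [← pow_add]; congr 1; omega
      have h3 : (2 : ℝ) ^ (k + 1) * (1 / 2) ^ (k + 1) = 1 := by
        rw [← mul_pow]; norm_num
      rw [h2]
      linear_combination -(2 ^ (n - k) / (n : ℝ)) * h3
    refine (Finset.sum_le_sum h1).trans (le_of_eq ?_)
    rw [Finset.sum_const, Finset.card_range, nsmul_eq_mul, mul_assoc]

/-- Logarithmic improvement of the restricted weak-type estimate. -/
theorem primitive_denseSet_pow_le (hw : AEMeasurable w (volume.restrict (Ioi 0)))
    (hp : 0 < p) {C : ℝ≥0} (hC1 : 1 ≤ C)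
    (hC : ∀ f : ℝ → ℝ, MemLorentz p u w f →
      weakLorentzNorm p u w (maximalFunction f) ≤ C * lorentzNorm p u w (fun x => ‖f x‖ₑ))
    {E : Set ℝ} (hE : NullMeasurableSet E volume) {n : ℕ} (hn : 1 ≤ n) :
    primitive w (weightMeasure u (denseSet E ((1 / 2) ^ n))) ≤
      ENNReal.ofReal (((C : ℝ) ^ p) ^ 2 * 32 ^ p * (2 ^ n) ^ p * (n : ℝ) ^ (1 - p)) *
        primitive w (weightMeasure u E) := by
  have hn0 : (0 : ℝ) < n := by exact_mod_cast hn
  have hC0 : (0 : ℝ) < C := by exact_mod_cast zero_lt_one.trans_le hC1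
  rcases eq_or_ne (primitive w (weightMeasure u E)) ∞ with htop | htop
  · rw [htop, ENNReal.mul_top]
    · exact le_top
    · rw [ne_eq, ENNReal.ofReal_eq_zero, not_le]
      positivity
  have hCp : (C : ℝ≥0∞) ^ p = ENNReal.ofReal ((C : ℝ) ^ p) := by
    rw [← ENNReal.ofReal_rpow_of_pos hC0, ENNReal.ofReal_coe_nnreal]
  have hnorm := lorentzNorm_densityLadder_rpow_le hw hp hC1 hC hE n
  have hK : (n : ℝ≥0∞) * ENNReal.ofReal (2 ^ (n + 1) / n) ^ p *
      ((C : ℝ≥0∞) ^ p * primitive w (weightMeasure u E)) ≠ ∞ := by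
    rw [hCp, ENNReal.ofReal_rpow_of_pos (by positivity)]
    exact ENNReal.mul_ne_top (ENNReal.mul_ne_top (ENNReal.natCast_ne_top n) ENNReal.ofReal_ne_top)
      (ENNReal.mul_ne_top ENNReal.ofReal_ne_top htop)
  have h1 := rpow_mul_primitive_superlevel_le hp hC (measurable_densityLadder E n).aemeasurable hK
    hnorm (ENNReal.ofReal (1 / 16))
  have h2 : primitive w (weightMeasure u (denseSet E ((1 / 2) ^ n))) ≤
      primitive w (weightMeasure u
        {x | ENNReal.ofReal (1 / 16) < maximalFunction (densityLadder E n) x}) :=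
    primitive_mono w (measure_mono (denseSet_subset_lt_maximalFunction_densityLadder E hn))
  refine h2.trans ?_
  have h3 : ENNReal.ofReal ((16 : ℝ) ^ p) * ENNReal.ofReal (1 / 16) ^ p = 1 := by
    rw [ENNReal.ofReal_rpow_of_pos (by norm_num), ← ENNReal.ofReal_mul (by positivity),
      ← Real.mul_rpow (by norm_num) (by norm_num)]
    norm_num
  have h4 := mul_le_mul_right h1 (ENNReal.ofReal ((16 : ℝ) ^ p))
  rw [← mul_assoc, h3, one_mul] at h4
  refine h4.trans (le_of_eq ?_)
  rw [hCp, ENNReal.ofReal_rpow_of_pos (by positivity), ← ENNReal.ofReal_natCast n]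
  simp only [← mul_assoc]
  rw [← ENNReal.ofReal_mul (by positivity), ← ENNReal.ofReal_mul (by positivity),
    ← ENNReal.ofReal_mul (by positivity), ← ENNReal.ofReal_mul (by positivity)]
  congr 2
  have h5 : ((2 : ℝ) ^ (n + 1) / n) ^ p = 2 ^ p * (2 ^ n) ^ p / n ^ p := by
    rw [Real.div_rpow (by positivity) hn0.le, pow_succ', Real.mul_rpow (by norm_num)
      (by positivity)]
  have h6 : (32 : ℝ) ^ p = 16 ^ p * 2 ^ p := by
    rw [← Real.mul_rpow (by norm_num) (by norm_num)]; norm_num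
  rw [h5, h6, Real.rpow_sub hn0, Real.rpow_one]
  ring

/-- One scale at which the restricted weak-type constant beats the power `p` iterates. -/
theorem primitive_denseSet_pow_mul_le {m : ℕ} (hm : 1 ≤ m) {A : ℝ≥0∞}
    (hA : ∀ E : Set ℝ, NullMeasurableSet E volume →
      primitive w (weightMeasure u (denseSet E ((1 / 2) ^ (m + 4)))) ≤
        A * primitive w (weightMeasure u E))
    {E : Set ℝ} (hE : NullMeasurableSet E volume) (k : ℕ) :
    primitive w (weightMeasure u (denseSet E ((1 / 2) ^ (m * (k + 1))))) ≤
      A ^ (k + 1) * primitive w (weightMeasure u E) := by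
  induction k with
  | zero =>
    rw [zero_add, mul_one, pow_one]
    refine (primitive_mono w (measure_mono (denseSet_anti E ?_))).trans (hA E hE)
    exact pow_le_pow_of_le_one (by norm_num) (by norm_num) (by omega)
  | succ k ih =>
    -- Composing density sets loses the factor 1/16 = 2^(-4): the estimate is used at scale m + 4
    -- while the density only advances by 2^(-m).
    have h1 : denseSet E ((1 / 2) ^ (m * (k + 1 + 1))) ⊆
        denseSet (denseSet E ((1 / 2) ^ (m * (k + 1)))) ((1 / 2) ^ (m + 4)) := by
      have h2 : (1 / 2 : ℝ) ^ (m * (k + 1 + 1)) = (1 / 2) ^ (m * (k + 1)) * (1 / 2) ^ m := by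
        rw [← pow_add]; congr 1
      have h3 : (1 / 2 : ℝ) ^ (m + 4) = (1 / 2) ^ m / 16 := by
        rw [pow_add]; norm_num; ring
      rw [h2, h3]
      exact denseSet_mul_subset E (by positivity)
        (pow_lt_one₀ (by norm_num) (by norm_num) (Nat.mul_pos hm (by omega)).ne') (by positivity)
        (pow_le_one₀ (by norm_num) (by norm_num))
    refine (primitive_mono w (measure_mono h1)).trans
      ((hA _ (isOpen_denseSet E _).measurableSet.nullMeasurableSet).trans ?_)
    rw [pow_succ' A (k + 1), mul_assoc]
    gcongr

end WeakBounded

/-! ### From density sets to the power bound on `Wbar`. -/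

theorem _root_.Set.OrdConnected.exists_subset_Icc {I : Set ℝ} (hI : I.OrdConnected)
    (h0 : volume I ≠ 0) (h1 : volume I ≠ ∞) :
    ∃ a b : ℝ, a < b ∧ I ⊆ Icc a b ∧ volume I = ENNReal.ofReal (b - a) := by
  have hne : I.Nonempty := nonempty_of_measure_ne_zero h0
  obtain ⟨y, hy⟩ := hne
  have hA : BddAbove I := by
    by_contra hb
    rw [not_bddAbove_iff] at hb
    refine h1 (top_le_iff.1 ((Real.volume_Ici (a := y)).symm.le.trans (measure_mono fun z hz => ?_)))
    obtain ⟨z', hz', hzz⟩ := hb z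
    exact hI.out hy hz' ⟨hz, hzz.le⟩
  have hB : BddBelow I := by
    by_contra hb
    rw [not_bddBelow_iff] at hb
    refine h1 (top_le_iff.1 ((Real.volume_Iic (a := y)).symm.le.trans (measure_mono fun z hz => ?_)))
    obtain ⟨z', hz', hzz⟩ := hb z
    exact hI.out hz' hy ⟨hzz.le, hz⟩
  have hsub : I ⊆ Icc (sInf I) (sSup I) := fun z hz => ⟨csInf_le hB hz, le_csSup hA hz⟩
  have hsup : Ioo (sInf I) (sSup I) ⊆ I :=
    IsConnected.Ioo_csInf_csSup_subset ⟨⟨y, hy⟩, hI.isPreconnected⟩ hB hA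
  have hvol : volume I = ENNReal.ofReal (sSup I - sInf I) := by
    refine le_antisymm ?_ ?_
    · simpa using measure_mono (μ := volume) hsub
    · simpa using measure_mono (μ := volume) hsup
  refine ⟨sInf I, sSup I, ?_, hsub, hvol⟩
  rw [hvol, ne_eq, ENNReal.ofReal_eq_zero, not_le] at h0
  linarith

theorem Admissible.iUnion_subset_denseSet {t : ℝ} (ht : 1 < t) {J : ℕ} {I S : Fin J → Set ℝ}
    (h : Admissible t I S) {l : ℝ} (hl : l ≤ 1 / t) : ⋃ j, I j ⊆ denseSet (⋃ j, S j) l := by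
  refine (iUnion_subset fun j x hx => ?_).trans (denseSet_anti _ hl)
  have hlen := h.length_lt j
  have hI0 : volume (I j) ≠ 0 := by
    intro h0
    have hS := measure_mono_null (h.subset j) h0
    simp [h0, hS] at hlen
  obtain ⟨a, b, hab, hsub, hvol⟩ := (h.interval j).exists_subset_Icc hI0 hlen.ne_top
  refine ⟨a, b, hab, hsub hx, ?_⟩
  have h1 : volume (S j) ≤ volume ((⋃ j, S j) ∩ Icc a b) :=
    measure_mono fun y hy => ⟨mem_iUnion.2 ⟨j, hy⟩, hsub (h.subset j hy)⟩
  refine lt_of_lt_of_le ?_ h1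
  have ht0 : 0 < t := by linarith
  rw [ENNReal.ofReal_mul (by positivity), ← hvol, one_div, ENNReal.ofReal_inv_of_pos ht0, mul_comm,
    ← div_eq_mul_inv, ENNReal.div_lt_iff (Or.inl (by simpa using ht0))
    (Or.inl ENNReal.ofReal_ne_top), mul_comm]
  exact hlen

theorem WeakBounded.exists_Wbar_le {p : ℝ} (hp : 1 < p) {u w : ℝ → ℝ}
    (hw : AEMeasurable w (volume.restrict (Ioi 0))) (h : WeakBounded p u w) :
    ∃ q : ℝ, q < p ∧ ∃ C : ℝ≥0, ∀ t : ℝ, 1 < t → Wbar u w t ≤ C * ENNReal.ofReal (t ^ q) := by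
  have hp0 : 0 < p := by linarith
  obtain ⟨C, hC1, hC⟩ := h.exists_one_le
  set K : ℝ := ((C : ℝ) ^ p) ^ 2 * 32 ^ p * 16 ^ p with hK
  have hC0 : (0 : ℝ) < C := by exact_mod_cast zero_lt_one.trans_le hC1
  have hK0 : 0 < K := by positivity
  -- The only use of p > 1: the gain n^(1-p) at n = m + 4 beats all constants, including the 16^p
  -- lost at each iteration.
  obtain ⟨m, hm1, hmK⟩ : ∃ m : ℕ, 1 ≤ m ∧ K * ((m + 4 : ℕ) : ℝ) ^ (1 - p) < 1 := by
    have h1 : Tendsto (fun m : ℕ => K * ((m + 4 : ℕ) : ℝ) ^ (1 - p)) atTop (𝓝 (K * 0)) := by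
      refine Tendsto.const_mul K ?_
      have h2 := (tendsto_rpow_neg_atTop (sub_pos.2 hp)).comp
        (tendsto_natCast_atTop_atTop.comp (tendsto_add_atTop_nat 4))
      simpa [Function.comp_def] using h2
    rw [mul_zero] at h1
    obtain ⟨m, hm⟩ := ((h1.eventually (gt_mem_nhds one_pos)).and (eventually_ge_atTop 1)).exists
    exact ⟨m, hm.2, hm.1⟩
  set y : ℝ := 2 ^ m with hy
  have hy1 : 1 < y := one_lt_pow₀ (by norm_num) (by omega)
  have hy0 : 0 < y := by positivity
  -- A is the cost of one step of size y = 2^m. From 1 ≤ A < y^p the exponent q = log_y A satisfies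
  -- 0 ≤ q < p.
  set A : ℝ := max 1 (K * ((m + 4 : ℕ) : ℝ) ^ (1 - p) * y ^ p) with hA
  have hA1 : 1 ≤ A := le_max_left _ _
  have hAy : A < y ^ p := by
    refine max_lt (Real.one_lt_rpow hy1 hp0) ?_
    have : 0 < y ^ p := by positivity
    nlinarith
  have hAE : ∀ E : Set ℝ, NullMeasurableSet E volume →
      primitive w (weightMeasure u (denseSet E ((1 / 2) ^ (m + 4)))) ≤
        ENNReal.ofReal A * primitive w (weightMeasure u E) := by
    intro E hE
    refine (primitive_denseSet_pow_le hw hp0 hC1 hC hE (n := m + 4) (by omega)).trans ?_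
    gcongr
    refine le_trans (le_of_eq ?_) (le_max_right _ _)
    have h16 : ((2 : ℝ) ^ (m + 4)) ^ p = y ^ p * 16 ^ p := by
      rw [pow_add, Real.mul_rpow (by positivity) (by positivity)]; norm_num [hy]
    rw [h16, hK]
    ring
  set q : ℝ := Real.logb y A with hq
  have hyq : y ^ q = A := Real.rpow_logb hy0 hy1.ne' (by linarith)
  have hq0 : 0 ≤ q := Real.logb_nonneg hy1 hA1
  have hqp : q < p := by
    rw [← hyq] at hAy
    exact (Real.rpow_lt_rpow_left_iff hy1).1 hAy
  refine ⟨q, hqp, A.toNNReal, fun t ht => ?_⟩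
  -- With y^n ≤ t < y^(n+1), n + 1 iterations reach density 1/t, and A^(n+1) = A (y^n)^q ≤ A t^q.
  obtain ⟨n, hn1, hn2⟩ := exists_nat_pow_near ht.le hy1
  have hAn : A ^ (n + 1) ≤ A * t ^ q := by
    have h1 : A ^ n = (y ^ n) ^ q := by
      rw [← hyq, ← Real.rpow_natCast, ← Real.rpow_natCast, ← Real.rpow_mul hy0.le,
        ← Real.rpow_mul hy0.le, mul_comm]
    rw [pow_succ', h1]
    gcongr
  refine iSup_le fun J => iSup_le fun I => iSup_le fun S => iSup_le fun hadm => ?_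
  refine ENNReal.div_le_of_le_mul ?_
  have hl : ((1 : ℝ) / 2) ^ (m * (n + 1)) ≤ 1 / t := by
    rw [pow_mul, one_div_pow, one_div_pow]
    exact one_div_le_one_div_of_le (by linarith) hn2.le
  refine (primitive_mono w (measure_mono (hadm.iUnion_subset_denseSet ht hl))).trans ?_
  refine (primitive_denseSet_pow_mul_le hm1 hAE (.iUnion hadm.measurable) n).trans ?_
  gcongr
  change _ ≤ ENNReal.ofReal A * _
  rw [← ENNReal.ofReal_pow (by linarith), ← ENNReal.ofReal_mul (by linarith)]
  exact ENNReal.ofReal_le_ofReal hAn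

/-! ### Restricted weak-type estimates from `Wbar` by Besicovitch coverings. -/

section WeightMeasure

variable {u : ℝ → ℝ}

theorem weightMeasure_ne_top_of_isCompact (hu : LocallyIntegrable u volume) {K : Set ℝ}
    (hK : IsCompact K) : weightMeasure u K ≠ ∞ := by
  rw [weightMeasure, withDensity_apply _ hK.measurableSet]
  exact (hu.integrableOn_isCompact hK).lintegral_lt_top.ne

theorem weightMeasure_ne_zero (hu : LocallyIntegrable u volume) (hpos : ∀ᵐ x : ℝ, 0 < u x)
    {S : Set ℝ} (hS : volume S ≠ 0) : weightMeasure u S ≠ 0 := by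
  have hac : (volume : Measure ℝ) ≪ weightMeasure u := by
    refine withDensity_absolutelyContinuous' hu.aestronglyMeasurable.aemeasurable.ennreal_ofReal ?_
    filter_upwards [hpos] with x hx
    simpa using hx
  exact fun h => hS (hac h)

end WeightMeasure

section RestrictedWeakType

variable {u w : ℝ → ℝ}

/-- The estimate defining `Wbar` for a finite disjoint family of balls in which `E` is dense. -/
theorem primitive_biUnion_closedBall_le (hu : LocallyIntegrable u volume)
    (hu_pos : ∀ᵐ x : ℝ, 0 < u x)
    (hw : ∀ r : ℝ, 0 < r → IntegrableOn w (Ioc 0 r) volume) (hw_pos : ∀ᵐ s : ℝ, 0 < s → 0 < w s)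
    {E : Set ℝ} (hE : NullMeasurableSet E volume) {t : ℝ} {β : Type*} (F : Finset β) {c r : β → ℝ}
    (hd : (F : Set β).PairwiseDisjoint fun j => Metric.closedBall (c j) (r j))
    (hlen : ∀ j ∈ F, volume (Metric.closedBall (c j) (r j)) <
      ENNReal.ofReal t * volume (E ∩ Metric.closedBall (c j) (r j))) :
    primitive w (weightMeasure u (⋃ j ∈ F, Metric.closedBall (c j) (r j))) ≤
      Wbar u w t * primitive w (weightMeasure u E) := by
  rcases F.eq_empty_or_nonempty with rfl | ⟨j₀, hj₀⟩
  · simp [primitive_zero]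
  set e := F.equivFin.symm
  set I : Fin F.card → Set ℝ := fun i => Metric.closedBall (c (e i)) (r (e i)) with hI
  set S : Fin F.card → Set ℝ := fun i => E ∩ I i with hS
  have hadm : Admissible t I S := by
    refine ⟨fun i => ?_, fun i k hik => ?_, fun i => ?_, fun i => inter_subset_right,
      fun i => hlen _ (e i).2⟩
    · rw [hI]
      simp only [Real.closedBall_eq_Icc]
      exact ordConnected_Icc
    · exact hd (e i).2 (e k).2 fun h => hik (e.injective (Subtype.ext h))
    · exact hE.inter Metric.isClosed_closedBall.measurableSet.nullMeasurableSet
  have hIU : ⋃ i, I i = ⋃ j ∈ F, Metric.closedBall (c j) (r j) := by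
    ext x
    simp only [mem_iUnion, exists_prop]
    constructor
    · rintro ⟨i, hi⟩
      exact ⟨e i, (e i).2, hi⟩
    · rintro ⟨j, hj, hx⟩
      refine ⟨e.symm ⟨j, hj⟩, ?_⟩
      simpa [hI] using hx
  have hle : primitive w (weightMeasure u (⋃ i, I i)) / primitive w (weightMeasure u (⋃ i, S i)) ≤
      Wbar u w t :=
    le_iSup_of_le _ (le_iSup_of_le I (le_iSup_of_le S (le_iSup_of_le hadm le_rfl)))
  -- The quotient in `Wbar` may be cleared only once its denominator is known to be positive and
  -- finite: positivity of u and w gives the former, boundedness of the finitely many balls the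
  -- latter.
  have hS0 : primitive w (weightMeasure u (⋃ i, S i)) ≠ 0 := by
    refine primitive_ne_zero hw hw_pos (weightMeasure_ne_zero hu hu_pos fun h0 => ?_)
    have h1 := hadm.length_lt (e.symm ⟨j₀, hj₀⟩)
    rw [measure_mono_null (subset_iUnion S _) h0, mul_zero] at h1
    exact not_lt_bot h1
  have hST : primitive w (weightMeasure u (⋃ i, S i)) ≠ ∞ := by
    refine primitive_ne_top hw (ne_top_of_le_ne_top (weightMeasure_ne_top_of_isCompact hu
      (isCompact_iUnion fun i => isCompact_closedBall (c (e i)) (r (e i)))) (measure_mono ?_))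
    exact iUnion_mono fun i => inter_subset_right
  rw [ENNReal.div_le_iff hS0 hST, hIU] at hle
  refine hle.trans ?_
  gcongr
  exact primitive_mono w (measure_mono (iUnion_subset fun i => inter_subset_left))

theorem primitive_biUnion_closedBall_le_of_countable (hu : LocallyIntegrable u volume)
    (hu_pos : ∀ᵐ x : ℝ, 0 < u x)
    (hw : ∀ r : ℝ, 0 < r → IntegrableOn w (Ioc 0 r) volume) (hw_pos : ∀ᵐ s : ℝ, 0 < s → 0 < w s)
    {E : Set ℝ} (hE : NullMeasurableSet E volume) {t : ℝ} {β : Type*} {F : Set β}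
    (hF : F.Countable) {c r : β → ℝ}
    (hd : F.PairwiseDisjoint fun j => Metric.closedBall (c j) (r j))
    (hlen : ∀ j ∈ F, volume (Metric.closedBall (c j) (r j)) <
      ENNReal.ofReal t * volume (E ∩ Metric.closedBall (c j) (r j))) :
    primitive w (weightMeasure u (⋃ j ∈ F, Metric.closedBall (c j) (r j))) ≤
      Wbar u w t * primitive w (weightMeasure u E) := by
  classical
  rcases F.eq_empty_or_nonempty with rfl | hne
  · simp [primitive_zero]
  obtain ⟨φ, rfl⟩ := hF.exists_eq_range hne
  set V : ℕ → Set ℝ := fun n => ⋃ j ∈ (Finset.range n).image φ, Metric.closedBall (c j) (r j)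
    with hV
  have hVm : Monotone V := fun m n hmn => biUnion_subset_biUnion_left
    (Finset.coe_subset.2 (Finset.image_subset_image (Finset.range_mono hmn)))
  have hVU : ⋃ j ∈ range φ, Metric.closedBall (c j) (r j) = ⋃ n, V n := by
    ext x
    simp only [hV, mem_iUnion, mem_range, Finset.mem_image, Finset.mem_range, exists_prop]
    constructor
    · rintro ⟨_, ⟨k, rfl⟩, hx⟩
      exact ⟨k + 1, φ k, ⟨k, by omega, rfl⟩, hx⟩
    · rintro ⟨_, _, ⟨k, _, rfl⟩, hx⟩
      exact ⟨φ k, ⟨k, rfl⟩, hx⟩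
  rw [hVU, hVm.measure_iUnion, primitive_iSup w fun m n hmn => measure_mono (hVm hmn)]
  refine iSup_le fun n => ?_
  have hsub : (((Finset.range n).image φ : Finset β) : Set β) ⊆ range φ := by
    rw [Finset.coe_image]
    exact image_subset_range _ _
  exact primitive_biUnion_closedBall_le hu hu_pos hw hw_pos hE _ (hd.subset hsub)
    fun j hj => hlen j (hsub hj)

/-- Restricted weak-type estimate in terms of `Wbar`. -/
theorem exists_primitive_denseSet_le (hu : LocallyIntegrable u volume)
    (hu_pos : ∀ᵐ x : ℝ, 0 < u x)
    (hw : ∀ r : ℝ, 0 < r → IntegrableOn w (Ioc 0 r) volume) (hw_pos : ∀ᵐ s : ℝ, 0 < s → 0 < w s)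
    {D : ℝ≥0} (hD : ∀ a : ℝ≥0∞, primitive w (2 * a) ≤ D * primitive w a) :
    ∃ K : ℝ≥0, ∀ E : Set ℝ, NullMeasurableSet E volume → ∀ l : ℝ, 0 < l →
      primitive w (weightMeasure u (denseSet E l)) ≤
        K * (Wbar u w (2 / l) * primitive w (weightMeasure u E)) := by
  obtain ⟨N, τ, hτ, hN⟩ := HasBesicovitchCovering.no_satelliteConfig (α := ℝ)
  refine ⟨D ^ N, fun E hE l hl => ?_⟩
  -- Besicovitch's theorem needs bounded radii, so the interval lengths are truncated at n and the
  -- truncation is removed by left continuity of W.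
  set U : ℕ → Set ℝ := fun n => {x | ∃ a b : ℝ, a < b ∧ b - a ≤ n ∧ x ∈ Icc a b ∧
    ENNReal.ofReal (l * (b - a)) < volume (E ∩ Icc a b)} with hU
  have hUm : Monotone U := fun m n hmn x ⟨a, b, hab, hle, hx⟩ =>
    ⟨a, b, hab, hle.trans (by exact_mod_cast hmn), hx⟩
  have hUU : denseSet E l = ⋃ n, U n := by
    ext x
    simp only [mem_iUnion]
    refine ⟨fun ⟨a, b, hab, hx⟩ => ?_, fun ⟨n, a, b, hab, _, hx⟩ => ⟨a, b, hab, hx⟩⟩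
    obtain ⟨n, hn⟩ := exists_nat_ge (b - a)
    exact ⟨n, a, b, hab, hn, hx⟩
  rw [hUU, hUm.measure_iUnion, primitive_iSup w fun m n hmn => measure_mono (hUm hmn)]
  refine iSup_le fun n => ?_
  choose! a b hab hle hmem hdens using fun x (hx : x ∈ U n) => hx
  -- The ball about x of radius b - a contains the interval and has twice its length, hence the
  -- argument 2/l of `Wbar`.
  let B : Besicovitch.BallPackage (U n) ℝ :=
    { c := fun x => x
      r := fun x => b x - a x
      rpos := fun x => sub_pos.2 (hab x x.2)
      r_bound := n
      r_le := fun x => hle x x.2 }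
  obtain ⟨s, hsd, hcov⟩ := Besicovitch.exist_disjoint_covering_families hτ hN B
  have hlen : ∀ x : U n, volume (Metric.closedBall (B.c x) (B.r x)) <
      ENNReal.ofReal (2 / l) * volume (E ∩ Metric.closedBall (B.c x) (B.r x)) := by
    intro x
    have hba : 0 < b x - a x := sub_pos.2 (hab x x.2)
    have hsub : Icc (a x) (b x) ⊆ Metric.closedBall (B.c x) (B.r x) := by
      rw [Real.closedBall_eq_Icc]
      have h1 := hmem x x.2
      change Icc (a x) (b x) ⊆ Icc ((x : ℝ) - (b x - a x)) ((x : ℝ) + (b x - a x))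
      exact Icc_subset_Icc (by linarith [h1.2]) (by linarith [h1.1])
    have h2 := (hdens x x.2).trans_le (measure_mono (inter_subset_inter_right E hsub))
    calc volume (Metric.closedBall (B.c x) (B.r x))
        = ENNReal.ofReal (2 / l) * ENNReal.ofReal (l * (b x - a x)) := by
          rw [Real.volume_closedBall, ← ENNReal.ofReal_mul (by positivity)]
          congr 1
          change 2 * (b x - a x) = _
          field_simp
      _ < _ := by
          refine (ENNReal.mul_lt_mul_iff_right ?_ ENNReal.ofReal_ne_top).2 h2
          rw [ne_eq, ENNReal.ofReal_eq_zero, not_le]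
          positivity
  set V : Fin N → Set ℝ := fun i => ⋃ j ∈ s i, Metric.closedBall (B.c j) (B.r j) with hV
  have hVle : ∀ i, primitive w (weightMeasure u (V i)) ≤
      Wbar u w (2 / l) * primitive w (weightMeasure u E) := by
    intro i
    have hc : (s i).Countable := (hsd i).countable_of_nonempty_interior fun x _ =>
      ⟨B.c x, Metric.ball_subset_interior_closedBall (Metric.mem_ball_self (B.rpos x))⟩
    exact primitive_biUnion_closedBall_le_of_countable hu hu_pos hw hw_pos hE hc (hsd i)
      fun j _ => hlen j
  have hUV : U n ⊆ ⋃ i, V i := by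
    intro x hx
    have h1 := hcov ⟨⟨x, hx⟩, rfl⟩
    simp only [mem_iUnion] at h1 ⊢
    obtain ⟨i, j, hj, hxj⟩ := h1
    exact ⟨i, mem_biUnion hj (Metric.ball_subset_closedBall hxj)⟩
  rcases isEmpty_or_nonempty (Fin N) with hem | hne
  · have h0 : U n = ∅ := by
      rw [iUnion_of_empty] at hUV
      exact subset_empty_iff.1 hUV
    rw [h0, measure_empty, primitive_zero]
    exact bot_le
  -- Only the largest of the N disjoint families matters: N ≤ 2^N, and N doublings of the argument
  -- of W cost D^N.
  obtain ⟨i₀, hi₀⟩ := Finite.exists_max fun i => weightMeasure u (V i)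
  have h1 : weightMeasure u (U n) ≤ 2 ^ N * weightMeasure u (V i₀) := by
    refine (measure_mono hUV).trans ((measure_iUnion_fintype_le _ _).trans ?_)
    refine (Finset.sum_le_sum fun i _ => hi₀ i).trans ?_
    rw [Finset.sum_const, Finset.card_univ, Fintype.card_fin, nsmul_eq_mul]
    gcongr
    exact_mod_cast Nat.lt_two_pow_self.le
  refine (primitive_mono w h1).trans ((primitive_two_pow_mul_le hD N _).trans ?_)
  rw [ENNReal.coe_pow]
  gcongr
  exact hVle i₀

end RestrictedWeakType

/-! ### Superlevel sets of Mf through geometric levels of f. -/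

theorem enorm_le_add_tsum_indicator {f : ℝ → ℝ} {B s : ℝ} (hB : 1 < B) (hs : 0 < s) (x : ℝ) :
    ‖f x‖ₑ ≤ ENNReal.ofReal (B * s) + ∑' j : ℕ,
      {x | ENNReal.ofReal (B ^ j * s) < ‖f x‖ₑ}.indicator
        (fun _ => ENNReal.ofReal (B ^ (j + 1) * s)) x := by
  rw [Real.enorm_eq_ofReal_abs]
  set v := |f x| with hv
  rcases le_or_gt v (B * s) with h | h
  · exact (ENNReal.ofReal_le_ofReal h).trans le_self_add
  have hB0 : 0 < B := by linarith
  obtain ⟨j, hj1, hj2⟩ : ∃ j : ℕ, B ^ j * s < v ∧ v ≤ B ^ (j + 1) * s := by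
    obtain ⟨n, hn1, hn2⟩ := exists_nat_pow_near (x := v / s) (y := B)
      ((one_le_div hs).2 (by nlinarith)) hB
    rw [le_div_iff₀ hs] at hn1
    rw [div_lt_iff₀ hs] at hn2
    -- The level sets are strict, so a value equal to B^n s is assigned to the preceding level.
    rcases hn1.lt_or_eq with h1 | h1
    · exact ⟨n, h1, hn2.le⟩
    · cases n with
      | zero => nlinarith
      | succ k =>
        refine ⟨k, ?_, h1.ge⟩
        rw [← h1]
        exact mul_lt_mul_of_pos_right (pow_lt_pow_right₀ hB (Nat.lt_succ_self k)) hs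
  refine le_trans ?_ (le_add_left (ENNReal.le_tsum j))
  rw [indicator_of_mem]
  · exact ENNReal.ofReal_le_ofReal hj2
  · rw [mem_ofPred_eq, Real.enorm_eq_ofReal_abs]
    exact (ENNReal.ofReal_lt_ofReal_iff (by linarith [mul_pos hB0 hs])).2 hj1

/-- Superlevel sets of `Mf` are covered by density sets of the superlevel sets of `f`. -/
theorem superlevel_maximalFunction_subset {f : ℝ → ℝ} (hf : AEMeasurable f volume) {B s : ℝ}
    (hB : 1 < B) (hs : 0 < s) :
    {x | ENNReal.ofReal (2 * B * s) < maximalFunction f x} ⊆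
      ⋃ j : ℕ, denseSet {x | ENNReal.ofReal (B ^ j * s) < ‖f x‖ₑ} (1 / (2 * (2 * B) ^ j)) := by
  have hB0 : 0 < B := by linarith
  intro x hx
  rw [mem_ofPred_eq, ofReal_lt_maximalFunction_iff (by positivity)] at hx
  obtain ⟨a, b, hab, hxI, hlt⟩ := hx
  have hba : 0 < b - a := sub_pos.2 hab
  by_contra hne
  simp only [mem_iUnion, not_exists] at hne
  refine hlt.not_ge ?_
  set E : ℕ → Set ℝ := fun j => {x | ENNReal.ofReal (B ^ j * s) < ‖f x‖ₑ} with hE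
  have hEm : ∀ j, NullMeasurableSet (E j) volume := fun j =>
    nullMeasurableSet_lt aemeasurable_const hf.enorm
  have hEr : ∀ j, NullMeasurableSet (E j) (volume.restrict (Icc a b)) := fun j =>
    (hEm j).mono_ac Measure.restrict_le_self.absolutelyContinuous
  have hsmall : ∀ j, volume (E j ∩ Icc a b) ≤
      ENNReal.ofReal (1 / (2 * (2 * B) ^ j) * (b - a)) := fun j => by
    by_contra! h
    exact hne j ⟨a, b, hab, hxI, h⟩
  calc ∫⁻ y in Icc a b, ‖f y‖ₑ
      ≤ ∫⁻ y in Icc a b, (ENNReal.ofReal (B * s) + ∑' j : ℕ,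
        (E j).indicator (fun _ => ENNReal.ofReal (B ^ (j + 1) * s)) y) :=
        lintegral_mono fun y => enorm_le_add_tsum_indicator hB hs y
    _ = ENNReal.ofReal (B * s) * volume (Icc a b) +
        ∑' j : ℕ, ENNReal.ofReal (B ^ (j + 1) * s) * volume (E j ∩ Icc a b) := by
        rw [lintegral_add_left measurable_const, setLIntegral_const,
          lintegral_tsum fun j => aemeasurable_const.indicator₀ (hEr j)]
        congr 2
        ext j
        rw [lintegral_indicator₀ (hEr j), setLIntegral_const,
          Measure.restrict_apply₀' measurableSet_Icc.nullMeasurableSet]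
    -- The densities are chosen so that B^(j+1) s / (2 (2B)^j) = B s 2^(-(j+1)). The levels then add
    -- up to a second copy of B s, contradicting an average above 2 B s.
    _ ≤ ENNReal.ofReal (B * s * (b - a)) +
        ∑' j : ℕ, ENNReal.ofReal (B * s * (b - a)) * 2⁻¹ ^ (j + 1) := by
        rw [Real.volume_Icc, ← ENNReal.ofReal_mul (by positivity)]
        refine add_le_add le_rfl (ENNReal.tsum_le_tsum fun j => ?_)
        refine (mul_le_mul_right (hsmall j) _).trans (le_of_eq ?_)
        have h2 : (2⁻¹ : ℝ≥0∞) ^ (j + 1) = ENNReal.ofReal (2⁻¹ ^ (j + 1)) := by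
          rw [ENNReal.ofReal_pow (by norm_num), ENNReal.ofReal_inv_of_pos (by norm_num)]
          norm_num
        rw [h2, ← ENNReal.ofReal_mul (by positivity), ← ENNReal.ofReal_mul (by positivity)]
        congr 1
        rw [mul_pow, inv_pow]
        field_simp
        ring
    _ = ENNReal.ofReal (2 * B * s * (b - a)) := by
        rw [ENNReal.tsum_mul_left, ENNReal.tsum_geometric_add_one, ENNReal.one_sub_inv_two, inv_inv,
          ENNReal.inv_mul_cancel (by norm_num) (by norm_num), mul_one,
          ← ENNReal.ofReal_add (by positivity) (by positivity)]
        congr 1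
        ring

/-! ### Strong boundedness by integrating the level-set estimate. -/

section Strong

variable {u w : ℝ → ℝ} {p : ℝ}

/-- Layer-cake formula after dilating the levels by `c`. -/
theorem lintegral_primitive_superlevel_scaled (hw : AEMeasurable w (volume.restrict (Ioi 0)))
    (hp : 0 < p) (g : ℝ → ℝ≥0∞) {c : ℝ} (hc : 0 < c) :
    ENNReal.ofReal p * ∫⁻ s in Ioi (0 : ℝ),
      primitive w (weightMeasure u {x | ENNReal.ofReal (c * s) < g x}) *
        ENNReal.ofReal (s ^ (p - 1)) = ENNReal.ofReal (c ^ (-p)) * lorentzNorm p u w g ^ p := by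
  have hc0 : ENNReal.ofReal c ≠ 0 := by simpa using hc
  have hset : ∀ s : ℝ≥0∞, {x | s < (ENNReal.ofReal c)⁻¹ * g x} =
      {x | ENNReal.ofReal c * s < g x} := fun s => by
    ext x
    rw [mem_ofPred_eq, mem_ofPred_eq, mul_comm _ (g x), ← div_eq_mul_inv,
      ENNReal.lt_div_iff_mul_lt (Or.inl hc0) (Or.inl ENNReal.ofReal_ne_top), mul_comm]
  -- Dilating the levels by c amounts to dividing g by c, and the rearrangement is homogeneous.
  have hre : ∀ t, rearrangement u (fun x => (ENNReal.ofReal c)⁻¹ * g x) t =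
      (ENNReal.ofReal c)⁻¹ * rearrangement u g t := fun t => by
    refine eq_of_forall_ge_iff fun s => ?_
    rw [rearrangement_le_iff, hset, ← rearrangement_le_iff, mul_comm _ (rearrangement u g t),
      ← div_eq_mul_inv, ENNReal.div_le_iff_le_mul (Or.inl hc0) (Or.inl ENNReal.ofReal_ne_top),
      mul_comm]
  have h1 := lorentzNorm_rpow_eq_layercake (u := u) (g := fun x => (ENNReal.ofReal c)⁻¹ * g x) hw hp
  simp only [hset] at h1
  simp only [ENNReal.ofReal_mul hc.le]
  rw [← h1, lorentzNorm_rpow hw hp, lorentzNorm_rpow hw hp]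
  simp only [hre, ENNReal.mul_rpow_of_nonneg _ _ hp.le]
  rw [lintegral_const_mul _ (rearrangement_antitone.measurable.pow_const p), ENNReal.inv_rpow,
    ENNReal.ofReal_rpow_of_pos hc, Real.rpow_neg hc.le,
    ENNReal.ofReal_inv_of_pos (Real.rpow_pos_of_pos hc p)]

theorem measurable_primitive_superlevel (u w : ℝ → ℝ) (g : ℝ → ℝ≥0∞) {c : ℝ} (hc : 0 < c) :
    Measurable fun s : ℝ => primitive w (weightMeasure u {x | ENNReal.ofReal (c * s) < g x}) := by
  refine Antitone.measurable fun s s' hs => primitive_mono w (measure_mono fun x hx => ?_)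
  exact lt_of_le_of_lt (ENNReal.ofReal_le_ofReal (mul_le_mul_of_nonneg_left hs hc.le)) hx

theorem strongBounded_of_Wbar_le (hp : 0 < p) (hu : LocallyIntegrable u volume)
    (hu_pos : ∀ᵐ x : ℝ, 0 < u x)
    (hw : ∀ r : ℝ, 0 < r → IntegrableOn w (Ioc 0 r) volume) (hw_pos : ∀ᵐ s : ℝ, 0 < s → 0 < w s)
    (hΔ : DeltaTwo w) {q : ℝ} (hq : q < p) {C : ℝ≥0}
    (hC : ∀ t : ℝ, 1 < t → Wbar u w t ≤ C * ENNReal.ofReal (t ^ q)) : StrongBounded p u w := by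
  have hwm := aemeasurable_of_integrableOn_Ioc hw
  obtain ⟨D, hD⟩ := hΔ.exists_doubling
  obtain ⟨K, hK⟩ := exists_primitive_denseSet_le hu hu_pos hw hw_pos hD
  -- The slack p - q is spent here: a large B makes the ratio of the final geometric series less
  -- than 1 despite the doubling constant D.
  obtain ⟨B, hB, hBr⟩ : ∃ B : ℝ, 1 < B ∧ (D : ℝ) * 2 ^ q * B ^ (-(p - q)) < 1 := by
    have h1 : Tendsto (fun B : ℝ => (D : ℝ) * 2 ^ q * B ^ (-(p - q))) atTop
        (𝓝 ((D : ℝ) * 2 ^ q * 0)) := (tendsto_rpow_neg_atTop (sub_pos.2 hq)).const_mul _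
    rw [mul_zero] at h1
    obtain ⟨B, hB⟩ := ((h1.eventually (gt_mem_nhds one_pos)).and (eventually_gt_atTop 1)).exists
    exact ⟨B, hB.2, hB.1⟩
  have hB0 : 0 < B := by linarith
  set ρ : ℝ := (D : ℝ) * 2 ^ q * B ^ (-(p - q)) with hρ
  have hρ0 : 0 ≤ ρ := by positivity
  -- The cost of level j: D^(j+1) from the quasi-subadditivity of W, and `Wbar` at 2/l = 4 (2B)^j
  -- for density l = 1/(2 (2B)^j).
  set c : ℕ → ℝ≥0∞ := fun j => D * (D ^ j * (K * (C * ENNReal.ofReal ((4 * (2 * B) ^ j) ^ q))))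
    with hc
  have hlevel : ∀ f : ℝ → ℝ, AEMeasurable f volume → ∀ s : ℝ, 0 < s →
      primitive w (weightMeasure u {x | ENNReal.ofReal (2 * B * s) < maximalFunction f x}) ≤
        ∑' j, c j * primitive w (weightMeasure u {x | ENNReal.ofReal (B ^ j * s) < ‖f x‖ₑ}) := by
    intro f hf s hs
    refine (primitive_mono w ((measure_mono (superlevel_maximalFunction_subset hf hB hs)).trans
      (measure_iUnion_le _))).trans ((primitive_tsum_le hD _).trans ?_)
    rw [← ENNReal.tsum_mul_left]
    refine ENNReal.tsum_le_tsum fun j => ?_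
    have h1 := hK {x | ENNReal.ofReal (B ^ j * s) < ‖f x‖ₑ}
      (nullMeasurableSet_lt aemeasurable_const hf.enorm) (1 / (2 * (2 * B) ^ j)) (by positivity)
    have h2 : 2 / (1 / (2 * (2 * B) ^ j)) = 4 * (2 * B) ^ j := by
      field_simp; norm_num
    rw [h2] at h1
    have h3 : 1 < 4 * (2 * B) ^ j := by
      have : 1 ≤ (2 * B) ^ j := one_le_pow₀ (by linarith)
      linarith
    simp only [hc, mul_assoc]
    gcongr
    refine h1.trans ?_
    rw [← mul_assoc (C : ℝ≥0∞)]
    gcongr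
    exact hC _ h3
  have hterm : ∀ j, c j * ENNReal.ofReal ((B ^ j) ^ (-p)) =
      D * K * C * ENNReal.ofReal (4 ^ q) * ENNReal.ofReal ρ ^ j := by
    intro j
    have h1 : (4 * (2 * B) ^ j) ^ q * (B ^ j) ^ (-p) = 4 ^ q * (2 ^ q * B ^ (-(p - q))) ^ j := by
      have e1 : ((2 * B) ^ j) ^ q = (2 ^ q) ^ j * (B ^ q) ^ j := by
        rw [← Real.rpow_natCast (2 * B), ← Real.rpow_mul (by positivity), mul_comm (j : ℝ),
          Real.rpow_mul (by positivity), Real.rpow_natCast, Real.mul_rpow (by norm_num) hB0.le,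
          mul_pow]
      have e2 : (B ^ j) ^ (-p) = (B ^ (-p)) ^ j := by
        rw [← Real.rpow_natCast B, ← Real.rpow_mul hB0.le, mul_comm (j : ℝ),
          Real.rpow_mul hB0.le, Real.rpow_natCast]
      have e3 : B ^ (-(p - q)) = B ^ q * B ^ (-p) := by
        rw [← Real.rpow_add hB0]; congr 1; ring
      rw [Real.mul_rpow (by norm_num) (by positivity), e1, e2, e3]
      ring
    have h2 : ENNReal.ofReal ρ ^ j =
        D ^ j * ENNReal.ofReal ((2 ^ q * B ^ (-(p - q))) ^ j) := by
      rw [hρ, mul_assoc, ENNReal.ofReal_mul (NNReal.coe_nonneg D), mul_pow, ENNReal.ofReal_coe_nnreal,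
        ENNReal.ofReal_pow (by positivity)]
    have h3 : ENNReal.ofReal ((4 * (2 * B) ^ j) ^ q) * ENNReal.ofReal ((B ^ j) ^ (-p)) =
        ENNReal.ofReal (4 ^ q) * ENNReal.ofReal ((2 ^ q * B ^ (-(p - q))) ^ j) := by
      rw [← ENNReal.ofReal_mul (by positivity), h1, ENNReal.ofReal_mul (by positivity)]
    rw [h2, hc]
    calc _ = D * K * C * D ^ j *
          (ENNReal.ofReal ((4 * (2 * B) ^ j) ^ q) * ENNReal.ofReal ((B ^ j) ^ (-p))) := by ring
      _ = _ := by rw [h3]; ring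
  set M : ℝ≥0∞ := D * K * C * ENNReal.ofReal (4 ^ q) * (1 - ENNReal.ofReal ρ)⁻¹ with hM
  have hMtop : M ≠ ∞ := by
    refine ENNReal.mul_ne_top (ENNReal.mul_ne_top (ENNReal.mul_ne_top (ENNReal.mul_ne_top
      ENNReal.coe_ne_top ENNReal.coe_ne_top) ENNReal.coe_ne_top) ENNReal.ofReal_ne_top) ?_
    rw [ne_eq, ENNReal.inv_eq_top, tsub_eq_zero_iff_le, not_le]
    simpa using hBr
  have hmain : ∀ f : ℝ → ℝ, AEMeasurable f volume →
      ENNReal.ofReal ((2 * B) ^ (-p)) * lorentzNorm p u w (maximalFunction f) ^ p ≤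
        M * lorentzNorm p u w (fun x => ‖f x‖ₑ) ^ p := by
    intro f hf
    rw [← lintegral_primitive_superlevel_scaled hwm hp _ (by positivity : 0 < 2 * B)]
    calc _ ≤ ENNReal.ofReal p * ∫⁻ s in Ioi (0 : ℝ), ∑' j, c j *
          (primitive w (weightMeasure u {x | ENNReal.ofReal (B ^ j * s) < ‖f x‖ₑ}) *
            ENNReal.ofReal (s ^ (p - 1))) := by
          gcongr 1
          refine setLIntegral_mono' measurableSet_Ioi fun s hs => ?_
          simp only [← mul_assoc]
          rw [ENNReal.tsum_mul_right]
          gcongr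
          exact hlevel f hf s hs
      _ = ∑' j, c j * (ENNReal.ofReal p * ∫⁻ s in Ioi (0 : ℝ),
            primitive w (weightMeasure u {x | ENNReal.ofReal (B ^ j * s) < ‖f x‖ₑ}) *
              ENNReal.ofReal (s ^ (p - 1))) := by
          have hmeas : ∀ j : ℕ, Measurable fun s : ℝ =>
              primitive w (weightMeasure u {x | ENNReal.ofReal (B ^ j * s) < ‖f x‖ₑ}) *
                ENNReal.ofReal (s ^ (p - 1)) := fun j =>
            (measurable_primitive_superlevel u w _ (by positivity)).mul (by fun_prop)
          rw [lintegral_tsum fun j => ((hmeas j).const_mul _).aemeasurable, ← ENNReal.tsum_mul_left]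
          refine tsum_congr fun j => ?_
          rw [lintegral_const_mul _ (hmeas j)]
          ring
      _ = ∑' j, c j * ENNReal.ofReal ((B ^ j) ^ (-p)) *
            lorentzNorm p u w (fun x => ‖f x‖ₑ) ^ p := by
          refine tsum_congr fun j => ?_
          rw [lintegral_primitive_superlevel_scaled hwm hp _ (by positivity), ← mul_assoc]
      _ = M * lorentzNorm p u w (fun x => ‖f x‖ₑ) ^ p := by
          simp only [hterm]
          rw [ENNReal.tsum_mul_right, ENNReal.tsum_mul_left, ENNReal.tsum_geometric]
  have hLtop : (ENNReal.ofReal ((2 * B) ^ p) * M) ^ (1 / p) ≠ ∞ :=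
    ENNReal.rpow_ne_top_of_nonneg (by positivity) (ENNReal.mul_ne_top ENNReal.ofReal_ne_top hMtop)
  refine ⟨((ENNReal.ofReal ((2 * B) ^ p) * M) ^ (1 / p)).toNNReal, fun f hf => ?_⟩
  rw [ENNReal.coe_toNNReal hLtop, ← ENNReal.rpow_le_rpow_iff hp,
    ENNReal.mul_rpow_of_nonneg _ _ hp.le, ← ENNReal.rpow_mul, one_div_mul_cancel hp.ne',
    ENNReal.rpow_one]
  have h1 := mul_le_mul_right (hmain f hf.1) (ENNReal.ofReal ((2 * B) ^ p))
  rwa [← mul_assoc, ← ENNReal.ofReal_mul (by positivity), ← Real.rpow_add (by positivity),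
    add_neg_cancel, Real.rpow_zero, ENNReal.ofReal_one, one_mul, ← mul_assoc] at h1

theorem StrongBounded.weakBounded (hw : AEMeasurable w (volume.restrict (Ioi 0))) (hp : 0 < p)
    (h : StrongBounded p u w) : WeakBounded p u w := by
  obtain ⟨C, hC⟩ := h
  exact ⟨C, fun f hf => (weakLorentzNorm_le_lorentzNorm hw hp).trans (hC f hf)⟩

end Strong

end WeightedLorentz

theorem mainTheorem3 (p : ℝ) (hp : 1 < p) (u w : ℝ → ℝ)
    (hu_pos : ∀ᵐ x : ℝ, 0 < u x)
    (hu_int : MeasureTheory.LocallyIntegrable u MeasureTheory.volume)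
    (hw_pos : ∀ᵐ s : ℝ, 0 < s → 0 < w s)
    (hw_int : ∀ r : ℝ, 0 < r → MeasureTheory.IntegrableOn w (Set.Ioc 0 r) MeasureTheory.volume)
    (hw_delta : WeightedLorentz.DeltaTwo w) :
    (WeightedLorentz.WeakBounded p u w ↔
      ∃ q : ℝ, q < p ∧ ∃ C : ℝ≥0, ∀ t : ℝ, 1 < t →
        WeightedLorentz.Wbar u w t ≤ C * ENNReal.ofReal (t ^ q)) ∧
    (WeightedLorentz.WeakBounded p u w ↔ WeightedLorentz.StrongBounded p u w) := by
  have hp0 : 0 < p := by linarith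
  have hwm := WeightedLorentz.aemeasurable_of_integrableOn_Ioc hw_int
  have h1 : WeightedLorentz.WeakBounded p u w → ∃ q : ℝ, q < p ∧ ∃ C : ℝ≥0, ∀ t : ℝ, 1 < t →
      WeightedLorentz.Wbar u w t ≤ C * ENNReal.ofReal (t ^ q) :=
    WeightedLorentz.WeakBounded.exists_Wbar_le hp hwm
  have h2 : (∃ q : ℝ, q < p ∧ ∃ C : ℝ≥0, ∀ t : ℝ, 1 < t →
      WeightedLorentz.Wbar u w t ≤ C * ENNReal.ofReal (t ^ q)) →
      WeightedLorentz.StrongBounded p u w := fun ⟨_, hq, _, hC⟩ =>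
    WeightedLorentz.strongBounded_of_Wbar_le hp0 hu_int hu_pos hw_int hw_pos hw_delta hq hC
  have h3 : WeightedLorentz.StrongBounded p u w → WeightedLorentz.WeakBounded p u w :=
    WeightedLorentz.StrongBounded.weakBounded hwm hp0
  exact ⟨⟨h1, fun h => h3 (h2 h)⟩, fun h => h2 (h1 h), h3⟩
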